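/- Let $X$ be a nonempty topological space. On subsets of $X$ write $a$ for complement, $b$ for closure, $i$ for interior and $f$ for boundary, $fA=bA\cap b(aA)$; products of operators are compositions, $\mathrm{id}$ is the identity and $0$ the operator with constant value $\varnothing$. Put $$\mathsf K^0=\{\mathrm{id},b,i,bi,ib,bib,ibi\},\quad \mathsf F^0=\{0,f,if,fif,bif,ff,fb,fi,fbi,fib\},$$ $$\mathsf K=\mathsf K^0\cup a\mathsf K^0,\qquad \mathsf{KF}=(\mathsf K^0\cup\mathsf F^0)\cup a(\mathsf K^0\cup\mathsf F^0)$$ (the Kuratowski and the Gaida–Eremenko monoid of $X$, generated under composition by $\{a,b\}$ and by $\{a,b,f\}$ respectively). Let $K(X)=|\mathsf K|$ and $K_f(X)=|\mathsf{KF}|$ be the numbers of distinct operators. For $A\subseteq X$ let $k(A)=|\{oA:o\in\mathsf K\}|$ and $k_f(A)=|\{oA:o\in\mathsf{KF}\}|$, and put $k(X)=\max_{A\subseteq X}k(A)$, $k_f(X)=\max_{A\subseteq X}k_f(A)$. Call $X$ a Kuratowski space if $K(X)=14$. Let $S$ be the set of those of the three words $ib$, $bi$, $b$ whose operators equal $bib$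 on $X$. The seven space types are: GE ($K_f(X)=34$); KD ($K_f(X)=28$); ED ($K(X)=10$, $S=\{ib\}$); OU ($K(X)=10$, $S=\{bi\}$); EO ($K(X)=8$, $S=\{ib,bi\}$); partition ($K(X)=6$, $S=\{ib,b\}$); discrete ($K(X)=2$, $S=\{ib,bi,b\}$). **Theorem.** For each type, the values of $k(X)$ and of $k_f(X)$ that occur as $X$ ranges over all nonempty spaces of that type are exactly the following. | type | values of $k(X)$ | values of $k_f(X)$ | |---|---|---| | GE | $8,10,12,14$ | $10,14,16,18,20,22,24,26,28,30,32,34$ | | KD | $10,12,14$ | $18,22,28$ | | ED | $4,6,8,10$ | $4,6,8,10,16,22$ | | OU | $4,6,8,10$ | $8,10,14,16,20$ | | EO | $4,6,8$ | $4,6,8,10,16$ | | partition | $4,6$ | $4,6,10$ | | discrete | $2$ | $2,4$ | In particular, no Kuratowski space has $k(X)=6$, no nonempty space has $k_f(X)=12$, and no KD space has $k_f(X)=20$. -/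

import Mathlib

universe u

namespace BoundaryMonoid

/-- Set operators on the power set of `X`; the product of two operators is their composition. -/
abbrev SetOp (X : Type u) : Type u := Set X → Set X

section Operators

variable (X : Type u) [TopologicalSpace X]

/-- The complement operator `a`. -/
def a : SetOp X := fun A => Aᶜ

/-- The closure operator `b`. -/
def b : SetOp X := fun A => closure A

/-- The interior operator `i`. -/
def i : SetOp X := fun A => interior A

/-- The boundary operator `f`, that is `f A = b A ∩ b (a A)`. -/
def f : SetOp X := fun A => closure A ∩ closure Aᶜ

/-- The zero operator. -/
def zero : SetOp X := fun _ => ∅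

/-- The even Kuratowski operators. -/
def K0 : Set (SetOp X) :=
  {id, b X, i X, b X ∘ i X, i X ∘ b X, b X ∘ i X ∘ b X, i X ∘ b X ∘ i X}

/-- The ten further even operators that involve the boundary. -/
def F0 : Set (SetOp X) :=
  {zero X, f X, i X ∘ f X, f X ∘ i X ∘ f X, b X ∘ i X ∘ f X, f X ∘ f X, f X ∘ b X, f X ∘ i X,
    f X ∘ b X ∘ i X, f X ∘ i X ∘ b X}

/-- `KF0 = K0 ∪ F0`. -/
def KF0 : Set (SetOp X) := K0 X ∪ F0 X

/-- The Kuratowski monoid `K = K0 ∪ a K0`. -/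
def K : Set (SetOp X) := K0 X ∪ (fun o => a X ∘ o) '' K0 X

/-- The Gaida–Eremenko monoid `KF = KF0 ∪ a KF0`. -/
def KF : Set (SetOp X) := KF0 X ∪ (fun o => a X ∘ o) '' KF0 X

/-- The `K`-number of a space: the number of distinct operators in `K`. -/
noncomputable def KNumber : ℕ := (K X).ncard

/-- The `K_f`-number of a space: the number of distinct operators in `KF`. -/
noncomputable def KfNumber : ℕ := (KF X).ncard

variable {X}

/-- The `k`-number of a subset: the number of distinct sets `o A` with `o ∈ K`. -/
noncomputable def kOf (A : Set X) : ℕ := ((fun o : SetOp X => o A) '' K X).ncard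

/-- The `k_f`-number of a subset: the number of distinct sets `o A` with `o ∈ KF`. -/
noncomputable def kfOf (A : Set X) : ℕ := ((fun o : SetOp X => o A) '' KF X).ncard

variable (X)

/-- The `k`-number of a space: the maximum of `kOf A` over all subsets `A`
(a maximum indeed, see `isGreatest_kNumber`). -/
noncomputable def kNumber : ℕ := sSup (Set.range fun A : Set X => kOf A)

/-- The `k_f`-number of a space: the maximum of `kfOf A` over all subsets `A`
(a maximum indeed, see `isGreatest_kfNumber`). -/
noncomputable def kfNumber : ℕ := sSup (Set.range fun A : Set X => kfOf A)

theorem K0_finite : (K0 X).Finite := by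
  unfold K0; exact Set.toFinite _

theorem F0_finite : (F0 X).Finite := by
  unfold F0; exact Set.toFinite _

theorem K_finite : (K X).Finite :=
  (K0_finite X).union ((K0_finite X).image _)

theorem KF_finite : (KF X).Finite :=
  ((K0_finite X).union (F0_finite X)).union (((K0_finite X).union (F0_finite X)).image _)

theorem isGreatest_kNumber :
    IsGreatest (Set.range fun A : Set X => kOf A) (kNumber X) := by
  have hb : BddAbove (Set.range fun A : Set X => kOf A) := by
    refine ⟨(K X).ncard, ?_⟩
    rintro _ ⟨A, rfl⟩
    exact Set.ncard_image_le (K_finite X)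
  exact ⟨Nat.sSup_mem (Set.range_nonempty _) hb, fun _ h => le_csSup hb h⟩

theorem isGreatest_kfNumber :
    IsGreatest (Set.range fun A : Set X => kfOf A) (kfNumber X) := by
  have hb : BddAbove (Set.range fun A : Set X => kfOf A) := by
    refine ⟨(KF X).ncard, ?_⟩
    rintro _ ⟨A, rfl⟩
    exact Set.ncard_image_le (KF_finite X)
  exact ⟨Nat.sSup_mem (Set.range_nonempty _) hb, fun _ h => le_csSup hb h⟩

/-- Kuratowski spaces are the spaces with `K`-number 14. -/
def IsKuratowski : Prop := KNumber X = 14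

end Operators

/-- The seven types of nonempty spaces: Gaida–Eremenko, Kuratowski disconnected,
extremally disconnected, open unresolvable, both of these, partition, discrete. -/
inductive SpaceType : Type
  | GE
  | KD
  | ED
  | OU
  | EO
  | partition
  | discrete

/-- `HasType X t`: the space `X` is of type `t`. GE and KD spaces are given by their `K_f`-number;
the other types by their `K`-number together with which of `ib`, `bi`, `b` are equal to `bib`. -/
def HasType (X : Type u) [TopologicalSpace X] : SpaceType → Prop
  | .GE => KfNumber X = 34
  | .KD => KfNumber X = 28
  | .ED => KNumber X = 10 ∧
      i X ∘ b X = b X ∘ i X ∘ b X ∧ b X ∘ i X ≠ b X ∘ i X ∘ b X ∧ b X ≠ b X ∘ i X ∘ b X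
  | .OU => KNumber X = 10 ∧
      i X ∘ b X ≠ b X ∘ i X ∘ b X ∧ b X ∘ i X = b X ∘ i X ∘ b X ∧ b X ≠ b X ∘ i X ∘ b X
  | .EO => KNumber X = 8 ∧
      i X ∘ b X = b X ∘ i X ∘ b X ∧ b X ∘ i X = b X ∘ i X ∘ b X ∧ b X ≠ b X ∘ i X ∘ b X
  | .partition => KNumber X = 6 ∧
      i X ∘ b X = b X ∘ i X ∘ b X ∧ b X ∘ i X ≠ b X ∘ i X ∘ b X ∧ b X = b X ∘ i X ∘ b X
  | .discrete => KNumber X = 2 ∧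
      i X ∘ b X = b X ∘ i X ∘ b X ∧ b X ∘ i X = b X ∘ i X ∘ b X ∧ b X = b X ∘ i X ∘ b X

/-- The set of all `k`-numbers of nonempty spaces of type `t`. -/
def kValues (t : SpaceType) : Set ℕ :=
  {n | ∃ (X : Type u) (_ : TopologicalSpace X) (_ : Nonempty X), HasType X t ∧ kNumber X = n}

/-- The set of all `k_f`-numbers of nonempty spaces of type `t`. -/
def kfValues (t : SpaceType) : Set ℕ :=
  {n | ∃ (X : Type u) (_ : TopologicalSpace X) (_ : Nonempty X), HasType X t ∧ kfNumber X = n}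

end BoundaryMonoid

namespace BoundaryMonoid

/-! Fix `A`. Every even operator applied to `A` gives a Boolean combination of `A`, its closure and
interior, the sets `ibi A`, `bi A`, `ib A`, `bib A`, and the closure of `ib A \ bi A`. The
inclusions among these leave sixteen possible membership patterns for a point, the cells
(`cell_spec`), and each word of the monoid is a fixed union of cells, encoded as a 16-bit mask
(`mem_wordOp_iff`). Hence `k(A)` and `k_f(A)` depend only on which cells are nonempty: they count
the distinct masks after intersection with that set. `K(X)` and `K_f(X)` are the same counts for
`allCells X`, the cells occupied by some subset. The occupied cells satisfy the implications in
`IsPattern`; running through the finitely many patterns that obey them gives the possible counts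
under prescribed absent and present cells.

Forgetting membership in `A` leaves nine regions, whose numbers appear in lemma names: one is cell 0
(`iA`), two is 2, 3 (the rest of `ibi A`), three is 8, 9 (`ib A ∩ bi A` outside `ibi A`), four is 6,
7 (`ib A \ bi A`), five and six are 10, 11 and 12, 13 (`bi A \ ib A`, off and on the closure of
region four), seven is 14, 15 (`bib A` outside `ib A ∪ bi A`), eight is 4, 5 (`bA \ bib A`), nine is
cell 1 (the exterior). In places a name means only one half of a region.

The space numbers are maxima over `A`, so excluding a value may require passing to a better subset.
Three arguments do this. Regions six and seven for one subset produce region three for another, so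
region three decides between GE and KD. If no subset has region three, the closure of an open set
that splits into two dense parts is open (`isOpen_closure_of_resolves`); a subset can then be
altered on a clopen set to gain region four without losing region five (`exists_four_five`,
`exists_four_five_two_or_eight`), which gives `k ≥ 10`, `k_f ≥ 18` and `k_f ≠ 20` for KD. Finally, a
subset with count 12 has, up to complement, cells 5 and 11, and deleting boundary points from it
yields a count of at least 14 (`exists_five_eight`, `kfNumber_ne_twelve`).

That the remaining values occur is shown by finite spaces, whose closure operator is computed on bit
masks. -/

/-! ### Counting distinct values by computation -/

/-- Boolean membership test for lists of natural numbers. -/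
def memNat (x : ℕ) : List ℕ → Bool
  | [] => false
  | y :: l => Nat.beq x y || memNat x l

/-- The number of distinct entries of a list of natural numbers. -/
def countDistinct : List ℕ → ℕ
  | [] => 0
  | x :: l => bif memNat x l then countDistinct l else countDistinct l + 1

theorem memNat_iff (x : ℕ) (l : List ℕ) : memNat x l = true ↔ x ∈ l := by
  induction l with
  | nil => simp [memNat]
  | cons y l ih => simp [memNat, ih]

theorem countDistinct_eq_card (l : List ℕ) : countDistinct l = l.toFinset.card := by
  induction l with
  | nil => rfl
  | cons x l ih =>
    by_cases h : x ∈ l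
    · have h' : memNat x l = true := (memNat_iff x l).2 h
      simp [countDistinct, h', ih, List.toFinset_cons, h]
    · have h' : memNat x l = false := Bool.eq_false_iff.2 (mt (memNat_iff x l).1 h)
      simp [countDistinct, h', ih, List.toFinset_cons, h]

/-- The number of distinct values `g x`, for `x` in a list, that are not bits of `acc`. (The
definition uses only operations that the kernel evaluates fast.) -/
noncomputable def countBits {ι : Type*} (g : ι → ℕ) (l : List ι) : ℕ → ℕ :=
  List.rec (fun _ => 0) (fun x _ ih acc =>
    Bool.rec (Nat.succ (ih (Nat.lor acc (Nat.shiftLeft 1 (g x))))) (ih acc)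
      (Nat.beq 1 (Nat.mod (Nat.shiftRight acc (g x)) 2))) l

theorem countBits_cons {ι : Type*} (g : ι → ℕ) (x : ι) (l : List ι) (acc : ℕ) :
    countBits g (x :: l) acc =
      bif acc.testBit (g x) then countBits g l acc
      else countBits g l (acc ||| (1 <<< g x)) + 1 := by
  have h : Nat.beq 1 (Nat.mod (Nat.shiftRight acc (g x)) 2) = acc.testBit (g x) := by
    rw [Nat.testBit_eq_decide_div_mod_eq, ← Nat.shiftRight_eq_div_pow, Bool.eq_iff_iff,
      Nat.beq_eq, decide_eq_true_iff, eq_comm]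
    rfl
  have h2 : ∀ (p q : ℕ) (t : Bool), Bool.rec (motive := fun _ => ℕ) p q t = bif t then q else p := by
    rintro p q ⟨⟩ <;> rfl
  rw [← h]
  exact h2 _ _ _

theorem testBit_or_one_shiftLeft (acc x y : ℕ) :
    (acc ||| (1 <<< x)).testBit y = true ↔ acc.testBit y = true ∨ y = x := by
  rw [Nat.testBit_or, Nat.shiftLeft_eq, one_mul, Nat.testBit_two_pow, Bool.or_eq_true,
    decide_eq_true_iff, @eq_comm _ y]

/-- The accumulator is the set of values seen so far, stored as bits; the induction needs it
arbitrary because it grows at each new value. -/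
theorem countBits_eq_card {ι : Type*} (g : ι → ℕ) (l : List ι) (acc : ℕ) :
    countBits g l acc = ((l.map g).toFinset.filter fun y => ¬ acc.testBit y = true).card := by
  induction l generalizing acc with
  | nil => rfl
  | cons x l ih =>
    rw [List.map_cons, List.toFinset_cons, Finset.filter_insert]
    by_cases h : acc.testBit (g x) = true
    · rw [countBits_cons, h, cond_true, ih]
      simp only [not_true_eq_false, if_false]
    · rw [countBits_cons, Bool.eq_false_iff.2 h, cond_false, if_pos (by simp)]
      simp only [ih, testBit_or_one_shiftLeft]
      rw [← Finset.card_insert_of_notMem (a := g x) (by simp)]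
      congr 1
      ext y
      simp only [Finset.mem_insert, Finset.mem_filter, List.mem_toFinset]
      by_cases hy : y = g x
      · simp [hy]
      · simp [hy]

theorem countBits_zero {ι : Type*} (g : ι → ℕ) (l : List ι) :
    countBits g l 0 = countDistinct (l.map g) := by
  rw [countBits_eq_card, countDistinct_eq_card]
  simp

/-- The bit mask of a list of numbers. -/
def listMask : List ℕ → ℕ
  | [] => 0
  | x :: l => listMask l ||| (1 <<< x)

theorem testBit_listMask (l : List ℕ) (n : ℕ) : (listMask l).testBit n = true ↔ n ∈ l := by
  induction l with
  | nil => simp [listMask]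
  | cons x l ih => rw [listMask, testBit_or_one_shiftLeft, ih, List.mem_cons, or_comm]

/-- Two families indexed by a list that have the same coincidences have equally many values. -/
theorem ncard_values_eq_countDistinct {ι α : Type*} (L : List ι) (f : ι → α) (g : ι → ℕ)
    (h : ∀ w ∈ L, ∀ w' ∈ L, f w = f w' ↔ g w = g w') :
    {y | ∃ w ∈ L, f w = y}.ncard = countDistinct (L.map g) := by
  classical
  have hset : {y | ∃ w ∈ L, f w = y} = ((L.map f).toFinset : Set α) := by
    ext y; simp
  rw [hset, Set.ncard_coe_finset, countDistinct_eq_card]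
  clear hset
  induction L with
  | nil => rfl
  | cons w L ih =>
    have ih' := ih fun v hv v' hv' => h v (by simp [hv]) v' (by simp [hv'])
    have hmem : f w ∈ L.map f ↔ g w ∈ L.map g := by
      simp only [List.mem_map]
      refine exists_congr fun v => and_congr_right fun hv => ?_
      exact h v (by simp [hv]) w (by simp)
    by_cases hw : f w ∈ L.map f
    · have hg := hmem.1 hw
      rw [List.map_cons, List.map_cons, List.toFinset_cons, List.toFinset_cons,
        Finset.insert_eq_of_mem (List.mem_toFinset.2 hw),
        Finset.insert_eq_of_mem (List.mem_toFinset.2 hg), ih']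
    · have hg := mt hmem.2 hw
      rw [List.map_cons, List.map_cons, List.toFinset_cons, List.toFinset_cons,
        Finset.card_insert_of_notMem (mt List.mem_toFinset.1 hw),
        Finset.card_insert_of_notMem (mt List.mem_toFinset.1 hg), ih']

/-! ### Operators as words -/

section Words

variable (X : Type u) [TopologicalSpace X]

/-- The even operators, in the order in which they are listed in `K0` and `F0`. -/
def evenOp : Fin 17 → SetOp X :=
  ![id, b X, i X, b X ∘ i X, i X ∘ b X, b X ∘ i X ∘ b X, i X ∘ b X ∘ i X,
    zero X, f X, i X ∘ f X, f X ∘ i X ∘ f X, b X ∘ i X ∘ f X, f X ∘ f X, f X ∘ b X, f X ∘ i X,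
    f X ∘ b X ∘ i X, f X ∘ i X ∘ b X]

/-- The operator of a word: an even operator, followed by the complement if the flag is set. -/
def wordOp (w : Bool × Fin 17) : SetOp X :=
  bif w.1 then a X ∘ evenOp X w.2 else evenOp X w.2

/-- The words of the Kuratowski monoid. -/
def kWords : List (Bool × Fin 17) :=
  [false, true].flatMap fun s => [0, 1, 2, 3, 4, 5, 6].map fun j => (s, j)

/-- The words of the Gaida–Eremenko monoid. -/
def kfWords : List (Bool × Fin 17) :=
  [false, true].flatMap fun s =>
    [0, 1, 2, 3, 4, 5, 6, 7, 8, 9, 10, 11, 12, 13, 14, 15, 16].map fun j => (s, j)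

theorem K0_eq : K0 X = {o | ∃ j ∈ ([0, 1, 2, 3, 4, 5, 6] : List (Fin 17)), evenOp X j = o} := by
  ext o
  simp only [K0, Set.mem_insert_iff, Set.mem_singleton_iff, Set.mem_ofPred_eq, List.mem_cons,
    List.not_mem_nil, or_false, exists_eq_or_imp, exists_eq_left, @eq_comm _ _ o]
  rfl

theorem KF0_eq : KF0 X = {o | ∃ j : Fin 17, evenOp X j = o} := by
  have h : ∀ j : Fin 17, j ∈ ([0, 1, 2, 3, 4, 5, 6, 7, 8, 9, 10, 11, 12, 13, 14, 15, 16] :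
      List (Fin 17)) := by decide
  have h' : ∀ o, (∃ j : Fin 17, evenOp X j = o) ↔
      ∃ j ∈ ([0, 1, 2, 3, 4, 5, 6, 7, 8, 9, 10, 11, 12, 13, 14, 15, 16] : List (Fin 17)),
        evenOp X j = o :=
    fun o => exists_congr fun j => by simp only [h, true_and]
  ext o
  rw [Set.mem_ofPred_eq, h']
  simp only [KF0, K0, F0, Set.mem_union, Set.mem_insert_iff, Set.mem_singleton_iff, List.mem_cons,
    List.not_mem_nil, or_false, exists_eq_or_imp, exists_eq_left, @eq_comm _ _ o, or_assoc]
  rfl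

theorem K_eq : K X = {o | ∃ w ∈ kWords, wordOp X w = o} := by
  have h : ∀ w, w ∈ kWords ↔ w.2 ∈ ([0, 1, 2, 3, 4, 5, 6] : List (Fin 17)) := by decide
  ext o
  simp only [K, K0_eq, h, Set.mem_union, Set.mem_image, Set.mem_ofPred_eq, Prod.exists,
    Bool.exists_bool, wordOp, cond_false, cond_true]
  refine or_congr Iff.rfl ?_
  constructor
  · rintro ⟨_, ⟨j, hj, rfl⟩, rfl⟩; exact ⟨j, hj, rfl⟩
  · rintro ⟨j, hj, rfl⟩; exact ⟨_, ⟨j, hj, rfl⟩, rfl⟩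

theorem KF_eq : KF X = {o | ∃ w ∈ kfWords, wordOp X w = o} := by
  have h : ∀ w, w ∈ kfWords := by decide
  ext o
  simp only [KF, KF0_eq, h, true_and, Set.mem_union, Set.mem_image, Set.mem_ofPred_eq, Prod.exists,
    Bool.exists_bool, wordOp, cond_false, cond_true]
  refine or_congr Iff.rfl ?_
  constructor
  · rintro ⟨_, ⟨j, rfl⟩, rfl⟩; exact ⟨j, rfl⟩
  · rintro ⟨j, rfl⟩; exact ⟨_, ⟨j, rfl⟩, rfl⟩

variable {X}

theorem kOf_eq_ncard (A : Set X) : kOf A = {y | ∃ w ∈ kWords, wordOp X w A = y}.ncard := by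
  unfold kOf
  rw [K_eq]
  congr 1
  ext y
  constructor
  · rintro ⟨_, ⟨w, hw, rfl⟩, rfl⟩; exact ⟨w, hw, rfl⟩
  · rintro ⟨w, hw, rfl⟩; exact ⟨_, ⟨w, hw, rfl⟩, rfl⟩

theorem kfOf_eq_ncard (A : Set X) : kfOf A = {y | ∃ w ∈ kfWords, wordOp X w A = y}.ncard := by
  unfold kfOf
  rw [KF_eq]
  congr 1
  ext y
  constructor
  · rintro ⟨_, ⟨w, hw, rfl⟩, rfl⟩; exact ⟨w, hw, rfl⟩
  · rintro ⟨w, hw, rfl⟩; exact ⟨_, ⟨w, hw, rfl⟩, rfl⟩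

end Words

/-! ### Patterns: which cells are nonempty -/

/-- The cells that make up the set `o A`, for each even operator `o`, as bit masks. -/
def evenMask : Fin 17 → ℕ :=
  ![43689, 65533, 1, 16141, 973, 65485, 13, 0, 65532, 192, 62208, 62400, 65340, 64560, 16140,
    16128, 64512]

/-- The cells that make up the set `o A`, for each word `o`, as bit masks. -/
def wordMask (w : Bool × Fin 17) : ℕ :=
  bif w.1 then 65535 - evenMask w.2 else evenMask w.2

/-- The masks of the words in the Kuratowski monoid. -/
def kMasks : List ℕ :=
  [43689, 65533, 1, 16141, 973, 65485, 13, 21846, 2, 65534, 49394, 64562, 50, 65522]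

/-- The masks of the words in the Gaida–Eremenko monoid. -/
def kfMasks : List ℕ :=
  [43689, 65533, 1, 16141, 973, 65485, 13, 0, 65532, 192, 62208, 62400, 65340, 64560, 16140,
    16128, 64512, 21846, 2, 65534, 49394, 64562, 50, 65522, 65535, 3, 65343, 3327, 3135, 195,
    975, 49395, 49407, 1023]

theorem map_wordMask_kWords : kWords.map wordMask = kMasks := by decide

theorem map_wordMask_kfWords : kfWords.map wordMask = kfMasks := by decide

/-- The number of distinct masks of the Kuratowski monoid on a bit pattern. -/
noncomputable def kBits (P : ℕ) : ℕ := countBits (fun m => Nat.land m P) kMasks 0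

/-- The number of distinct masks of the Gaida–Eremenko monoid on a bit pattern. -/
noncomputable def kfBits (P : ℕ) : ℕ := countBits (fun m => Nat.land m P) kfMasks 0

/-- A set of cells as a bit pattern. -/
noncomputable def bits (S : Set ℕ) : ℕ := by
  classical exact Nat.ofBits fun j : Fin 16 => decide ((j : ℕ) ∈ S)

theorem testBit_bits (S : Set ℕ) {j : ℕ} (hj : j < 16) : (bits S).testBit j = true ↔ j ∈ S := by
  rw [bits, Nat.testBit_ofBits_lt _ _ hj]
  simp

theorem testBit_bits_ge (S : Set ℕ) {j : ℕ} (hj : 16 ≤ j) : (bits S).testBit j = false := by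
  rw [bits, Nat.testBit_ofBits_ge _ _ hj]

theorem bits_lt (S : Set ℕ) : bits S < 65536 :=
  Nat.ofBits_lt_two_pow _

theorem and_bits_eq_iff (S : Set ℕ) (hS : ∀ j ∈ S, j < 16) (m m' : ℕ) :
    m &&& bits S = m' &&& bits S ↔ ∀ j ∈ S, m.testBit j = m'.testBit j := by
  constructor
  · intro h j hj
    have := congrArg (fun t => t.testBit j) h
    simpa [Nat.testBit_and, (testBit_bits S (hS j hj)).2 hj] using this
  · intro h
    refine Nat.eq_of_testBit_eq fun j => ?_
    rw [Nat.testBit_and, Nat.testBit_and]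
    by_cases hj : j ∈ S
    · rw [h j hj]
    · have : (bits S).testBit j = false := by
        rcases lt_or_ge j 16 with h16 | h16
        · simpa using mt (testBit_bits S h16).1 hj
        · exact testBit_bits_ge S h16
      simp [this]

/-- The closure conditions that the set of nonempty cells of a subset satisfies. -/
structure IsPattern (S : Set ℕ) : Prop where
  lt : ∀ j ∈ S, j < 16
  nonempty : S.Nonempty
  two_one : 2 ∈ S → 0 ∈ S
  two' : 3 ∈ S → 2 ∈ S
  eight_nine : 5 ∈ S → 1 ∈ S
  eight' : 4 ∈ S → 5 ∈ S
  four : 6 ∈ S ↔ 7 ∈ S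
  three : 8 ∈ S ∨ 9 ∈ S → 0 ∈ S ∧ 6 ∈ S
  five : 10 ∈ S ∨ 11 ∈ S → 0 ∈ S ∧ 1 ∈ S
  six : 12 ∈ S ∨ 13 ∈ S → 0 ∈ S ∧ 1 ∈ S ∧ 6 ∈ S
  seven : 14 ∈ S ∨ 15 ∈ S → 1 ∈ S ∧ 6 ∈ S

/-! ### Enumeration of the feasible patterns -/

/-- The part of the conditions `IsPattern` that concerns the low bits. -/
def lowOk (P : ℕ) : Bool :=
  (!P.testBit 2 || P.testBit 0) && (!P.testBit 3 || P.testBit 2) &&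
  (!P.testBit 5 || P.testBit 1) && (!P.testBit 4 || P.testBit 5) &&
  (P.testBit 6 == P.testBit 7)

/-- The possible contributions of the bits `k` and `k + 1` to a feasible bit pattern without the
bits `absent`, where `c` tells whether one of the two bits may occur. -/
def pairOptions (absent : List ℕ) (c : Bool) (k : ℕ) : List ℕ :=
  bif c then [0, 2 ^ k, 2 ^ (k + 1), 2 ^ k + 2 ^ (k + 1)].filter fun d => !absent.any d.testBit
  else [0]

/-- Test a Boolean property on all feasible bit patterns without the bits `absent`. -/
def allPatterns (absent : List ℕ) (φ : ℕ → Bool) : Bool :=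
  (List.range 256).all fun q => !lowOk q || absent.any q.testBit ||
    (pairOptions absent (q.testBit 0 && q.testBit 6) 8).all fun d₁ =>
    (pairOptions absent (q.testBit 0 && q.testBit 1) 10).all fun d₂ =>
    (pairOptions absent (q.testBit 0 && (q.testBit 1 && q.testBit 6)) 12).all fun d₃ =>
    (pairOptions absent (q.testBit 1 && q.testBit 6) 14).all fun d₄ =>
      φ (q ||| d₁ ||| d₂ ||| d₃ ||| d₄)

theorem and_mask_mem_pairOptions {absent : List ℕ} {c : Bool} {P : ℕ} (k : ℕ)
    (ha : ∀ j ∈ absent, P.testBit j = false)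
    (hc : P.testBit k = true ∨ P.testBit (k + 1) = true → c = true) :
    P &&& (2 ^ k ||| 2 ^ (k + 1)) ∈ pairOptions absent c k := by
  have hor : (2 ^ k ||| 2 ^ (k + 1) : ℕ) = 2 ^ k + 2 ^ (k + 1) := by
    have := Nat.two_pow_add_eq_or_of_lt (i := k + 1) (b := 2 ^ k)
      (Nat.pow_lt_pow_right (by norm_num) (by omega)) 1
    rw [mul_one] at this
    rw [Nat.or_comm, ← this, add_comm]
  have hval : P &&& (2 ^ k ||| 2 ^ (k + 1)) =
      (P.testBit k).toNat * 2 ^ k ||| (P.testBit (k + 1)).toNat * 2 ^ (k + 1) := by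
    rw [Nat.and_or_distrib_left, Nat.and_two_pow, Nat.and_two_pow]
  cases c with
  | false =>
    have h1 : P.testBit k = false := by
      by_contra h; simpa using hc (Or.inl (by simpa using h))
    have h2 : P.testBit (k + 1) = false := by
      by_contra h; simpa using hc (Or.inr (by simpa using h))
    rw [hval, h1, h2]
    simp [pairOptions]
  | true =>
    rw [pairOptions, cond_true, List.mem_filter]
    constructor
    · rw [hval]
      cases P.testBit k <;> cases P.testBit (k + 1) <;> simp [hor]
    · rw [Bool.not_eq_true', List.any_eq_false]
      intro j hj
      simp [Nat.testBit_and, ha j hj]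

/-- A pattern is the union of its low byte and four pairs of bits, for regions three, five, six and
seven. Each pair is constrained by the low byte alone, so the nested loops meet every pattern. -/
theorem allPatterns_spec {absent : List ℕ} {φ : ℕ → Bool} (h : allPatterns absent φ = true)
    {S : Set ℕ} (hS : IsPattern S) (ha : ∀ j ∈ absent, j ∉ S) : φ (bits S) = true := by
  set P := bits S with hP
  have hb : ∀ j, j < 16 → (P.testBit j = true ↔ j ∈ S) := fun j hj => testBit_bits S hj
  have hPlt : P < 2 ^ 16 := bits_lt S
  have ha' : ∀ j ∈ absent, P.testBit j = false := fun j hj => by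
    rcases lt_or_ge j 16 with h16 | h16
    · exact Bool.eq_false_iff.2 (mt (hb j h16).1 (ha j hj))
    · exact testBit_bits_ge S h16
  set q := P &&& 255 with hq
  have hqb : ∀ j, j < 8 → q.testBit j = P.testBit j := fun j hj => by
    have : (255 : ℕ).testBit j = true := by interval_cases j <;> rfl
    rw [hq, Nat.testBit_and, this, Bool.and_true]
  have hqlt : q < 256 := lt_of_le_of_lt Nat.and_le_right (by norm_num)
  have hqb' : ∀ j, j < 8 → (q.testBit j = true ↔ j ∈ S) := fun j hj => by
    rw [hqb j hj, hb j (by omega)]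
  have hlow : lowOk q = true := by
    have h2 := hS.two_one
    have h3 := hS.two'
    have h5 := hS.eight_nine
    have h4 := hS.eight'
    have h6 := hS.four
    simp only [← hqb' 0 (by norm_num), ← hqb' 1 (by norm_num), ← hqb' 2 (by norm_num),
      ← hqb' 3 (by norm_num), ← hqb' 4 (by norm_num), ← hqb' 5 (by norm_num),
      ← hqb' 6 (by norm_num), ← hqb' 7 (by norm_num)] at h2 h3 h4 h5 h6
    simp only [lowOk, Bool.and_eq_true, beq_iff_eq, Bool.eq_iff_iff (b := q.testBit 7)]
    refine ⟨⟨⟨⟨?_, ?_⟩, ?_⟩, ?_⟩, h6⟩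
    all_goals
      rw [Bool.or_eq_true, Bool.not_eq_true', ← Bool.not_eq_true, ← imp_iff_not_or]
      assumption
  have hq' : (!lowOk q || absent.any q.testBit) = false := by
    rw [hlow, Bool.not_true, Bool.false_or, List.any_eq_false]
    intro j hj
    simp [hq, Nat.testBit_and, ha' j hj]
  have h1 := List.all_eq_true.1 h q (List.mem_range.2 hqlt)
  rw [hq', Bool.false_or] at h1
  have hpair : ∀ k c, k + 1 < 16 → (k ∈ S ∨ k + 1 ∈ S → c = true) →
      P &&& (2 ^ k ||| 2 ^ (k + 1)) ∈ pairOptions absent c k := fun k c hk hc =>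
    and_mask_mem_pairOptions k ha' (by rwa [hb k (by omega), hb (k + 1) hk])
  have h3 := hpair 8 (q.testBit 0 && q.testBit 6) (by norm_num) (by
    simpa only [Bool.and_eq_true, hqb' 0 (by norm_num), hqb' 6 (by norm_num)] using hS.three)
  have h5 := hpair 10 (q.testBit 0 && q.testBit 1) (by norm_num) (by
    simpa only [Bool.and_eq_true, hqb' 0 (by norm_num), hqb' 1 (by norm_num)] using hS.five)
  have h6 := hpair 12 (q.testBit 0 && (q.testBit 1 && q.testBit 6)) (by norm_num) (by
    simpa only [Bool.and_eq_true, hqb' 0 (by norm_num), hqb' 1 (by norm_num),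
      hqb' 6 (by norm_num)] using hS.six)
  have h7 := hpair 14 (q.testBit 1 && q.testBit 6) (by norm_num) (by
    simpa only [Bool.and_eq_true, hqb' 1 (by norm_num), hqb' 6 (by norm_num)] using hS.seven)
  have h2 := List.all_eq_true.1 (List.all_eq_true.1 (List.all_eq_true.1
    (List.all_eq_true.1 h1 _ h3) _ h5) _ h6) _ h7
  have hPq : q ||| (P &&& (2 ^ 8 ||| 2 ^ (8 + 1))) ||| (P &&& (2 ^ 10 ||| 2 ^ (10 + 1))) |||
      (P &&& (2 ^ 12 ||| 2 ^ (12 + 1))) ||| (P &&& (2 ^ 14 ||| 2 ^ (14 + 1))) = P := by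
    rw [hq]
    simp only [← Nat.and_or_distrib_left]
    exact (Nat.and_two_pow_sub_one_eq_mod P 16).trans (Nat.mod_eq_of_lt hPlt)
  rwa [hPq] at h2

/-- Test that the count `c` takes only the listed values on the feasible bit patterns without the
bits `absent` and with at least one bit from each list in `present`. -/
def checkValues (c : ℕ → ℕ) (absent : List ℕ) (present : List (List ℕ)) (values : List ℕ) : Bool :=
  allPatterns absent fun P => Nat.beq P 0 || !(present.all fun l => l.any P.testBit) ||
    (listMask values).testBit (c P)

theorem checkValues_spec {c : ℕ → ℕ} {absent : List ℕ} {present : List (List ℕ)}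
    {values : List ℕ} (h : checkValues c absent present values = true) {S : Set ℕ}
    (hS : IsPattern S) (ha : ∀ j ∈ absent, j ∉ S) (hp : ∀ l ∈ present, ∃ j ∈ l, j ∈ S) :
    c (bits S) ∈ values := by
  have h1 := allPatterns_spec h hS ha
  have h3 : (present.all fun l => l.any (bits S).testBit) = true := by
    rw [List.all_eq_true]
    intro l hl
    obtain ⟨j, hj, hjS⟩ := hp l hl
    exact List.any_eq_true.2 ⟨j, hj, (testBit_bits S (hS.lt j hjS)).2 hjS⟩
  -- The test lets the zero pattern pass, so it has to be excluded here.
  have h0 : bits S ≠ 0 := fun h0 => by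
    obtain ⟨j, hj⟩ := hS.nonempty
    have := (testBit_bits S (hS.lt j hj)).2 hj
    simp [h0] at this
  rw [h3] at h1
  exact (testBit_listMask _ _).1 (by simpa [h0] using h1)

/-! ### Values of the counts on patterns -/

section Values

variable {S : Set ℕ}

/-- Used for the lower bound 10 in GE spaces. The entry 12 is possible for a single subset and is
excluded as a maximum only in `kfNumber_ne_twelve`. -/
theorem kfBits_of_three (hS : IsPattern S) (h0 : 8 ∈ S ∨ 9 ∈ S) : kfBits (bits S) ∈ ([10, 12,
    14, 16, 18, 20, 22, 24, 26, 28, 30, 32, 34] : List ℕ) :=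
  checkValues_spec (absent := []) (present := [[8, 9]])
    (by decide +kernel) hS (by simp) (by simpa using h0)

theorem kBits_of_three (hS : IsPattern S) (h0 : 8 ∈ S ∨ 9 ∈ S) : kBits (bits S) ∈ ([8, 10, 12,
    14] : List ℕ) :=
  checkValues_spec (absent := []) (present := [[8, 9]])
    (by decide +kernel) hS (by simp) (by simpa using h0)

/-- The absence of 28 is what keeps region three out of KD spaces. -/
theorem kfBits_of_three_seven (hS : IsPattern S) (h0 : 8 ∈ S ∨ 9 ∈ S) (h1 : 14 ∈ S ∨ 15 ∈ S) :
    kfBits (bits S) ∈ ([22, 26, 30, 34] : List ℕ) :=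
  checkValues_spec (absent := []) (present := [[8, 9], [14, 15]])
    (by decide +kernel) hS (by simp) (by simpa using ⟨h0, h1⟩)

theorem kfBits_mem_of_not_three (hS : IsPattern S) (ha : ∀ j ∈ ([8, 9, 12, 13, 14, 15] : List
    ℕ), j ∉ S) : kfBits (bits S) ∈ ([2, 4, 6, 8, 10, 12, 14, 16, 18, 20, 22, 28] : List ℕ) :=
  checkValues_spec (absent := [8, 9, 12, 13, 14, 15]) (present := [])
    (by decide +kernel) hS ha (by simp)

theorem kfBits_of_four_five (hS : IsPattern S) (ha : ∀ j ∈ ([8, 9, 12, 13, 14, 15] : List ℕ), j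
    ∉ S) (h0 : 6 ∈ S ∨ 7 ∈ S) (h1 : 10 ∈ S ∨ 11 ∈ S) : kfBits (bits S) ∈ ([18, 22, 28] : List ℕ)
    :=
  checkValues_spec (absent := [8, 9, 12, 13, 14, 15]) (present := [[6, 7], [10, 11]])
    (by decide +kernel) hS ha (by simpa using ⟨h0, h1⟩)

theorem kBits_of_four_five (hS : IsPattern S) (ha : ∀ j ∈ ([8, 9, 12, 13, 14, 15] : List ℕ), j ∉
    S) (h0 : 6 ∈ S ∨ 7 ∈ S) (h1 : 10 ∈ S ∨ 11 ∈ S) : kBits (bits S) ∈ ([10, 12, 14] : List ℕ) :=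
  checkValues_spec (absent := [8, 9, 12, 13, 14, 15]) (present := [[6, 7], [10, 11]])
    (by decide +kernel) hS ha (by simpa using ⟨h0, h1⟩)

/-- One further cell beside regions four and five removes the value 18; cell 5 has the same effect
in the next lemma. -/
theorem kfBits_of_four_five_two (hS : IsPattern S) (ha : ∀ j ∈ ([8, 9, 12, 13, 14, 15] : List
    ℕ), j ∉ S) (h0 : 6 ∈ S ∨ 7 ∈ S) (h1 : 10 ∈ S ∨ 11 ∈ S) (h2 : 2 ∈ S) : kfBits (bits S) ∈
    ([22, 28] : List ℕ) :=
  checkValues_spec (absent := [8, 9, 12, 13, 14, 15]) (present := [[6, 7], [10, 11], [2]])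
    (by decide +kernel) hS ha (by simpa using ⟨h0, h1, h2⟩)

theorem kfBits_of_four_five_eight (hS : IsPattern S) (ha : ∀ j ∈ ([8, 9, 12, 13, 14, 15] : List
    ℕ), j ∉ S) (h0 : 6 ∈ S ∨ 7 ∈ S) (h1 : 10 ∈ S ∨ 11 ∈ S) (h2 : 5 ∈ S) : kfBits (bits S) ∈
    ([22, 28] : List ℕ) :=
  checkValues_spec (absent := [8, 9, 12, 13, 14, 15]) (present := [[6, 7], [10, 11], [5]])
    (by decide +kernel) hS ha (by simpa using ⟨h0, h1, h2⟩)

theorem kfBits_mem_of_not_four (hS : IsPattern S) (ha : ∀ j ∈ ([8, 9, 12, 13, 14, 15, 6, 7] :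
    List ℕ), j ∉ S) : kfBits (bits S) ∈ ([2, 4, 6, 8, 10, 12, 14, 16, 20] : List ℕ) :=
  checkValues_spec (absent := [8, 9, 12, 13, 14, 15, 6, 7]) (present := [])
    (by decide +kernel) hS ha (by simp)

theorem kfBits_mem_of_not_five (hS : IsPattern S) (ha : ∀ j ∈ ([8, 9, 12, 13, 14, 15, 10, 11] :
    List ℕ), j ∉ S) : kfBits (bits S) ∈ ([2, 4, 6, 8, 10, 16, 22] : List ℕ) :=
  checkValues_spec (absent := [8, 9, 12, 13, 14, 15, 10, 11]) (present := [])
    (by decide +kernel) hS ha (by simp)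

/-- The point is that 20 is missing, as it is in `kfBits_mem_of_not_eight` and
`kfBits_mem_of_not_five`. So without regions three, six and seven, a count of 20 forces region five
and the cells 2 and 5. -/
theorem kfBits_mem_of_not_two (hS : IsPattern S) (ha : ∀ j ∈ ([8, 9, 12, 13, 14, 15, 2] : List
    ℕ), j ∉ S) : kfBits (bits S) ∈ ([2, 4, 6, 8, 10, 12, 14, 16, 18, 22, 28] : List ℕ) :=
  checkValues_spec (absent := [8, 9, 12, 13, 14, 15, 2]) (present := [])
    (by decide +kernel) hS ha (by simp)

theorem kfBits_mem_of_not_eight (hS : IsPattern S) (ha : ∀ j ∈ ([8, 9, 12, 13, 14, 15, 5] : List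
    ℕ), j ∉ S) : kfBits (bits S) ∈ ([2, 4, 6, 8, 10, 12, 14, 16, 18, 22, 28] : List ℕ) :=
  checkValues_spec (absent := [8, 9, 12, 13, 14, 15, 5]) (present := [])
    (by decide +kernel) hS ha (by simp)

theorem kfBits_of_five_eight (hS : IsPattern S) (h0 : 10 ∈ S) (h1 : 5 ∈ S) : kfBits (bits S) ∈
    ([14, 16, 18, 20, 22, 24, 26, 28, 30, 32, 34] : List ℕ) :=
  checkValues_spec (absent := []) (present := [[10], [5]])
    (by decide +kernel) hS (by simp) (by simpa using ⟨h0, h1⟩)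

/-- Only 12 is missing from the list. With the next three lemmas, a pattern of count 12 meets each
of `{2, 5}`, `{5, 10}`, `{2, 11}`, `{10, 11}`, so it contains `{5, 11}` or its dual `{2, 10}`. -/
theorem kfBits_ne_of_not_two_eight (hS : IsPattern S) (ha : ∀ j ∈ ([2, 5] : List ℕ), j ∉ S) :
    kfBits (bits S) ∈ ([2, 4, 6, 8, 10, 14, 16, 18, 20, 22, 24, 26, 28, 30, 32, 34] : List ℕ) :=
  checkValues_spec (absent := [2, 5]) (present := [])
    (by decide +kernel) hS ha (by simp)

theorem kfBits_ne_of_not_five_eight (hS : IsPattern S) (ha : ∀ j ∈ ([5, 10] : List ℕ), j ∉ S) :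
    kfBits (bits S) ∈ ([2, 4, 6, 8, 10, 14, 16, 18, 20, 22, 24, 26, 28, 30, 32, 34] : List ℕ) :=
  checkValues_spec (absent := [5, 10]) (present := [])
    (by decide +kernel) hS ha (by simp)

theorem kfBits_ne_of_not_two_five (hS : IsPattern S) (ha : ∀ j ∈ ([2, 11] : List ℕ), j ∉ S) :
    kfBits (bits S) ∈ ([2, 4, 6, 8, 10, 14, 16, 18, 20, 22, 24, 26, 28, 30, 32, 34] : List ℕ) :=
  checkValues_spec (absent := [2, 11]) (present := [])
    (by decide +kernel) hS ha (by simp)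

theorem kfBits_ne_of_not_five (hS : IsPattern S) (ha : ∀ j ∈ ([10, 11] : List ℕ), j ∉ S) :
    kfBits (bits S) ∈ ([2, 4, 6, 8, 10, 14, 16, 18, 20, 22, 24, 26, 28, 30, 32, 34] : List ℕ) :=
  checkValues_spec (absent := [10, 11]) (present := [])
    (by decide +kernel) hS ha (by simp)

theorem kBits_mem_of_not_four (hS : IsPattern S) (ha : ∀ j ∈ ([6, 7] : List ℕ), j ∉ S) : kBits
    (bits S) ∈ ([2, 4, 6, 8, 10, 12] : List ℕ) :=
  checkValues_spec (absent := [6, 7]) (present := [])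
    (by decide +kernel) hS ha (by simp)

theorem kBits_mem_of_not_five_six_seven (hS : IsPattern S) (ha : ∀ j ∈ ([10, 11, 12, 13, 14, 15]
    : List ℕ), j ∉ S) : kBits (bits S) ∈ ([2, 4, 6, 8, 10, 12] : List ℕ) :=
  checkValues_spec (absent := [10, 11, 12, 13, 14, 15]) (present := [])
    (by decide +kernel) hS ha (by simp)

theorem kfBits_mem_of_ED (hS : IsPattern S) (ha : ∀ j ∈ ([8, 9, 10, 11, 12, 13, 14, 15] : List
    ℕ), j ∉ S) : kfBits (bits S) ∈ ([2, 4, 6, 8, 10, 16, 22] : List ℕ) :=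
  checkValues_spec (absent := [8, 9, 10, 11, 12, 13, 14, 15]) (present := [])
    (by decide +kernel) hS ha (by simp)

theorem kBits_mem_of_ED (hS : IsPattern S) (ha : ∀ j ∈ ([8, 9, 10, 11, 12, 13, 14, 15] : List
    ℕ), j ∉ S) : kBits (bits S) ∈ ([2, 4, 6, 8, 10] : List ℕ) :=
  checkValues_spec (absent := [8, 9, 10, 11, 12, 13, 14, 15]) (present := [])
    (by decide +kernel) hS ha (by simp)

theorem kfBits_mem_of_OU (hS : IsPattern S) (ha : ∀ j ∈ ([6, 7, 8, 9, 12, 13, 14, 15] : List ℕ),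
    j ∉ S) : kfBits (bits S) ∈ ([2, 4, 6, 8, 10, 12, 14, 16, 20] : List ℕ) :=
  checkValues_spec (absent := [6, 7, 8, 9, 12, 13, 14, 15]) (present := [])
    (by decide +kernel) hS ha (by simp)

theorem kBits_mem_of_OU (hS : IsPattern S) (ha : ∀ j ∈ ([6, 7, 8, 9, 12, 13, 14, 15] : List ℕ),
    j ∉ S) : kBits (bits S) ∈ ([2, 4, 6, 8, 10] : List ℕ) :=
  checkValues_spec (absent := [6, 7, 8, 9, 12, 13, 14, 15]) (present := [])
    (by decide +kernel) hS ha (by simp)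

theorem kfBits_of_OU (hS : IsPattern S) (ha : ∀ j ∈ ([6, 7, 8, 9, 12, 13, 14, 15] : List ℕ), j ∉
    S) (h0 : 10 ∈ S ∨ 11 ∈ S) : kfBits (bits S) ∈ ([8, 10, 12, 14, 16, 20] : List ℕ) :=
  checkValues_spec (absent := [6, 7, 8, 9, 12, 13, 14, 15]) (present := [[10, 11]])
    (by decide +kernel) hS ha (by simpa using h0)

theorem kfBits_mem_of_EO (hS : IsPattern S) (ha : ∀ j ∈ ([6, 7, 8, 9, 10, 11, 12, 13, 14, 15] :
    List ℕ), j ∉ S) : kfBits (bits S) ∈ ([2, 4, 6, 8, 10, 16] : List ℕ) :=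
  checkValues_spec (absent := [6, 7, 8, 9, 10, 11, 12, 13, 14, 15]) (present := [])
    (by decide +kernel) hS ha (by simp)

theorem kBits_mem_of_EO (hS : IsPattern S) (ha : ∀ j ∈ ([6, 7, 8, 9, 10, 11, 12, 13, 14, 15] :
    List ℕ), j ∉ S) : kBits (bits S) ∈ ([2, 4, 6, 8] : List ℕ) :=
  checkValues_spec (absent := [6, 7, 8, 9, 10, 11, 12, 13, 14, 15]) (present := [])
    (by decide +kernel) hS ha (by simp)

theorem kfBits_mem_of_partition (hS : IsPattern S) (ha : ∀ j ∈ ([2, 3, 4, 5, 8, 9, 10, 11, 12,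
    13, 14, 15] : List ℕ), j ∉ S) : kfBits (bits S) ∈ ([2, 4, 6, 10] : List ℕ) :=
  checkValues_spec (absent := [2, 3, 4, 5, 8, 9, 10, 11, 12, 13, 14, 15]) (present := [])
    (by decide +kernel) hS ha (by simp)

theorem kBits_mem_of_partition (hS : IsPattern S) (ha : ∀ j ∈ ([2, 3, 4, 5, 8, 9, 10, 11, 12,
    13, 14, 15] : List ℕ), j ∉ S) : kBits (bits S) ∈ ([2, 4, 6] : List ℕ) :=
  checkValues_spec (absent := [2, 3, 4, 5, 8, 9, 10, 11, 12, 13, 14, 15]) (present := [])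
    (by decide +kernel) hS ha (by simp)

theorem kfBits_mem_of_discrete (hS : IsPattern S) (ha : ∀ j ∈ ([2, 3, 4, 5, 6, 7, 8, 9, 10, 11,
    12, 13, 14, 15] : List ℕ), j ∉ S) : kfBits (bits S) ∈ ([2, 4] : List ℕ) :=
  checkValues_spec (absent := [2, 3, 4, 5, 6, 7, 8, 9, 10, 11, 12, 13, 14, 15]) (present := [])
    (by decide +kernel) hS ha (by simp)

theorem kBits_mem_of_discrete (hS : IsPattern S) (ha : ∀ j ∈ ([2, 3, 4, 5, 6, 7, 8, 9, 10, 11,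
    12, 13, 14, 15] : List ℕ), j ∉ S) : kBits (bits S) ∈ ([2] : List ℕ) :=
  checkValues_spec (absent := [2, 3, 4, 5, 6, 7, 8, 9, 10, 11, 12, 13, 14, 15]) (present := [])
    (by decide +kernel) hS ha (by simp)

theorem kfBits_of_nondiscrete (hS : IsPattern S) (h0 : 2 ∈ S ∨ 3 ∈ S ∨ 4 ∈ S ∨ 5 ∈ S ∨ 6 ∈ S ∨ 7
    ∈ S ∨ 8 ∈ S ∨ 9 ∈ S ∨ 10 ∈ S ∨ 11 ∈ S ∨ 12 ∈ S ∨ 13 ∈ S ∨ 14 ∈ S ∨ 15 ∈ S) : kfBits (bits S)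
    ∈ ([4, 6, 8, 10, 12, 14, 16, 18, 20, 22, 24, 26, 28, 30, 32, 34] : List ℕ) :=
  checkValues_spec (absent := []) (present := [[2, 3, 4, 5, 6, 7, 8, 9, 10, 11, 12, 13, 14, 15]])
    (by decide +kernel) hS (by simp) (by simpa using h0)

theorem kBits_of_nondiscrete (hS : IsPattern S) (h0 : 2 ∈ S ∨ 3 ∈ S ∨ 4 ∈ S ∨ 5 ∈ S ∨ 6 ∈ S ∨ 7
    ∈ S ∨ 8 ∈ S ∨ 9 ∈ S ∨ 10 ∈ S ∨ 11 ∈ S ∨ 12 ∈ S ∨ 13 ∈ S ∨ 14 ∈ S ∨ 15 ∈ S) : kBits (bits S)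
    ∈ ([4, 6, 8, 10, 12, 14] : List ℕ) :=
  checkValues_spec (absent := []) (present := [[2, 3, 4, 5, 6, 7, 8, 9, 10, 11, 12, 13, 14, 15]])
    (by decide +kernel) hS (by simp) (by simpa using h0)

end Values

/-! ### The cells of a subset -/

section Cells

variable {X : Type u} [TopologicalSpace X] (A : Set X)

theorem interior_subset_ibi : interior A ⊆ interior (closure (interior A)) :=
  interior_maximal subset_closure isOpen_interior

theorem ibi_subset_ib : interior (closure (interior A)) ⊆ interior (closure A) :=
  interior_mono (closure_mono interior_subset)

theorem ib_subset_bib : interior (closure A) ⊆ closure (interior (closure A)) :=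
  subset_closure

theorem bi_subset_bib : closure (interior A) ⊆ closure (interior (closure A)) :=
  closure_mono (interior_mono subset_closure)

theorem bib_subset_b : closure (interior (closure A)) ⊆ closure A :=
  closure_minimal interior_subset isClosed_closure

theorem bif_subset_bib :
    closure (interior (closure A) \ closure (interior A)) ⊆ closure (interior (closure A)) :=
  closure_mono Set.sdiff_subset

theorem disjoint_bif_ibi {x : X}
    (h : x ∈ closure (interior (closure A) \ closure (interior A))) :
    x ∉ interior (closure (interior A)) := fun h' => by
  obtain ⟨y, hy, hy'⟩ := mem_closure_iff.1 h _ isOpen_interior h'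
  exact hy'.2 (interior_subset hy)

theorem bib_subset_union {x : X} (h : x ∈ closure (interior (closure A)))
    (h' : x ∉ closure (interior A)) :
    x ∈ closure (interior (closure A) \ closure (interior A)) := by
  rw [mem_closure_iff]
  intro U hU hx
  obtain ⟨y, hy, hy'⟩ := mem_closure_iff.1 h _ (hU.sdiff isClosed_closure) ⟨hx, h'⟩
  exact ⟨y, hy.1, hy', hy.2⟩

/-- If a neighborhood `U` of `x` missed `ib A \ bi A`, then the open set `U ∩ ib A` would lie in `bi
A`, putting `x` into `ibi A`. -/
theorem mem_bif_of_notMem_ibi {x : X} (h : x ∈ interior (closure A))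
    (h' : x ∉ interior (closure (interior A))) :
    x ∈ closure (interior (closure A) \ closure (interior A)) := by
  rw [mem_closure_iff]
  intro U hU hx
  by_contra hne
  apply h'
  refine mem_interior.2 ⟨U ∩ interior (closure A), fun y hy => ?_, hU.inter isOpen_interior, hx, h⟩
  by_contra hy'
  exact hne ⟨y, hy.1, hy.2, hy'⟩

theorem interior_frontier_eq : interior (closure A ∩ closure Aᶜ) =
    interior (closure A) \ closure (interior A) := by
  rw [interior_inter, closure_compl, interior_compl]; rfl

open Classical in
/-- The index of the cell of `A` in which a point lies. -/
noncomputable def cell (x : X) : ℕ :=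
  if x ∈ interior A then 0
  else if x ∉ closure A then 1
  else (if x ∈ interior (closure (interior A)) then 2
    else if x ∉ closure (interior (closure A)) then 4
    else if x ∈ interior (closure A) then (if x ∈ closure (interior A) then 8 else 6)
    else if x ∉ closure (interior A) then 14
    else if x ∈ closure (interior (closure A) \ closure (interior A)) then 12 else 10)
      + if x ∈ A then 1 else 0

theorem cell_lt (x : X) : cell A x < 16 := by
  unfold cell
  split_ifs <;> norm_num

open Classical in
/-- The possible membership patterns of a point in the sets generated by `A`. -/
theorem cell_spec (x : X) :
    let i := x ∈ interior A
    let m := x ∈ A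
    let b := x ∈ closure A
    let ibi := x ∈ interior (closure (interior A))
    let bi := x ∈ closure (interior A)
    let ib := x ∈ interior (closure A)
    let bib := x ∈ closure (interior (closure A))
    let z := x ∈ closure (interior (closure A) \ closure (interior A))
    (cell A x = 0 ∧ i ∧ m ∧ b ∧ ibi ∧ bi ∧ ib ∧ bib ∧ ¬ z) ∨
    (cell A x = 1 ∧ ¬ i ∧ ¬ m ∧ ¬ b ∧ ¬ ibi ∧ ¬ bi ∧ ¬ ib ∧ ¬ bib ∧ ¬ z) ∨
    (cell A x = 2 ∧ ¬ i ∧ ¬ m ∧ b ∧ ibi ∧ bi ∧ ib ∧ bib ∧ ¬ z) ∨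
    (cell A x = 3 ∧ ¬ i ∧ m ∧ b ∧ ibi ∧ bi ∧ ib ∧ bib ∧ ¬ z) ∨
    (cell A x = 4 ∧ ¬ i ∧ ¬ m ∧ b ∧ ¬ ibi ∧ ¬ bi ∧ ¬ ib ∧ ¬ bib ∧ ¬ z) ∨
    (cell A x = 5 ∧ ¬ i ∧ m ∧ b ∧ ¬ ibi ∧ ¬ bi ∧ ¬ ib ∧ ¬ bib ∧ ¬ z) ∨
    (cell A x = 6 ∧ ¬ i ∧ ¬ m ∧ b ∧ ¬ ibi ∧ ¬ bi ∧ ib ∧ bib ∧ z) ∨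
    (cell A x = 7 ∧ ¬ i ∧ m ∧ b ∧ ¬ ibi ∧ ¬ bi ∧ ib ∧ bib ∧ z) ∨
    (cell A x = 8 ∧ ¬ i ∧ ¬ m ∧ b ∧ ¬ ibi ∧ bi ∧ ib ∧ bib ∧ z) ∨
    (cell A x = 9 ∧ ¬ i ∧ m ∧ b ∧ ¬ ibi ∧ bi ∧ ib ∧ bib ∧ z) ∨
    (cell A x = 10 ∧ ¬ i ∧ ¬ m ∧ b ∧ ¬ ibi ∧ bi ∧ ¬ ib ∧ bib ∧ ¬ z) ∨
    (cell A x = 11 ∧ ¬ i ∧ m ∧ b ∧ ¬ ibi ∧ bi ∧ ¬ ib ∧ bib ∧ ¬ z) ∨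
    (cell A x = 12 ∧ ¬ i ∧ ¬ m ∧ b ∧ ¬ ibi ∧ bi ∧ ¬ ib ∧ bib ∧ z) ∨
    (cell A x = 13 ∧ ¬ i ∧ m ∧ b ∧ ¬ ibi ∧ bi ∧ ¬ ib ∧ bib ∧ z) ∨
    (cell A x = 14 ∧ ¬ i ∧ ¬ m ∧ b ∧ ¬ ibi ∧ ¬ bi ∧ ¬ ib ∧ bib ∧ z) ∨
    (cell A x = 15 ∧ ¬ i ∧ m ∧ b ∧ ¬ ibi ∧ ¬ bi ∧ ¬ ib ∧ bib ∧ z) := by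
  intro i m b ibi bi ib bib z
  -- These twelve implications are all that topology contributes; what follows is propositional
  -- logic, which is why the values are cleared.
  have h1 : i → ibi := fun h => interior_subset_ibi A h
  have h2 : ibi → ib := fun h => ibi_subset_ib A h
  have h3 : ibi → bi := fun h => interior_subset h
  have h4 : ib → bib := fun h => ib_subset_bib A h
  have h5 : bi → bib := fun h => bi_subset_bib A h
  have h6 : bib → b := fun h => bib_subset_b A h
  have h7 : z → bib := fun h => bif_subset_bib A h
  have h8 : z → ¬ ibi := fun h => disjoint_bif_ibi A h
  have h9 : bib → ¬ bi → z := fun h => bib_subset_union A h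
  have h10 : ib → ¬ ibi → z := fun h => mem_bif_of_notMem_ibi A h
  have h11 : i → m := fun h => interior_subset h
  have h12 : m → b := fun h => subset_closure h
  have hc : cell A x = if i then 0 else if ¬ b then 1 else (if ibi then 2 else if ¬ bib then 4
    else if ib then (if bi then 8 else 6) else if ¬ bi then 14 else if z then 12 else 10)
      + if m then 1 else 0 := rfl
  rw [hc]
  clear hc
  clear_value i m b ibi bi ib bib z
  by_cases hi : i
  · have := h1 hi; have := h11 hi; have := h12 this; have h := h2 (h1 hi); have := h3 (h1 hi)
    have := h4 h; have : ¬ z := fun t => h8 t (h1 hi)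
    simp only [*]; simp
  by_cases hb : b
  swap
  · have hbib := mt h6 hb
    have := mt h7 hbib; have := mt h5 hbib; have := mt h4 hbib; have := mt h12 hb
    have : ¬ ibi := fun t => hbib (h5 (h3 t))
    simp only [*]; simp
  by_cases hibi : ibi
  · have := h2 hibi; have := h3 hibi; have := h4 (h2 hibi); have : ¬ z := fun t => h8 t hibi
    by_cases hm : m <;> (simp only [*]; simp)
  by_cases hbib : bib
  swap
  · have := mt h7 hbib; have := mt h5 hbib; have := mt h4 hbib
    by_cases hm : m <;> (simp only [*]; simp)
  by_cases hib : ib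
  · have := h10 hib hibi
    by_cases hbi : bi <;> by_cases hm : m <;> (simp only [*]; simp)
  by_cases hbi : bi
  · by_cases hbif : z <;> by_cases hm : m <;> (simp only [*]; simp)
  · have := h9 hbib hbi
    by_cases hm : m <;> (simp only [*]; simp)

/-! ### Operators as unions of cells -/

variable {A}

/-- Since `f B = b B \ i B`, and `if A = ib A \ bi A` is open while `f A` is closed, all seventeen
values reduce to differences of the sets that define the cells. It remains to compare each with its
mask, cell by cell. -/
theorem mem_evenOp_iff (j : Fin 17) (x : X) :
    x ∈ evenOp X j A ↔ (evenMask j).testBit (cell A x) = true := by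
  have hif : interior (closure A ∩ closure Aᶜ) = interior (closure A) \ closure (interior A) :=
    interior_frontier_eq A
  have e (B : Set X) : closure B ∩ closure Bᶜ = closure B \ interior B := by
    rw [closure_compl]; rfl
  have hff : interior (closure A \ interior A) = interior (closure A) \ closure (interior A) := by
    rw [← e, hif]
  have hii : interior (interior (closure A) \ closure (interior A)) =
      interior (closure A) \ closure (interior A) :=
    (isOpen_interior.sdiff isClosed_closure).interior_eq
  have hcl : closure (closure A \ interior A) = closure A \ interior A :=
    (isClosed_closure.sdiff isOpen_interior).closure_eq
  have hset : evenOp X j A =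
      ![A, closure A, interior A, closure (interior A), interior (closure A),
        closure (interior (closure A)), interior (closure (interior A)), ∅,
        closure A \ interior A, interior (closure A) \ closure (interior A),
        closure (interior (closure A) \ closure (interior A)) \
          (interior (closure A) \ closure (interior A)),
        closure (interior (closure A) \ closure (interior A)),
        (closure A \ interior A) \ (interior (closure A) \ closure (interior A)),
        closure A \ interior (closure A), closure (interior A) \ interior A,
        closure (interior A) \ interior (closure (interior A)),
        closure (interior (closure A)) \ interior (closure A)] j := by
    have hf : ∀ B : Set X, f X B = closure B \ interior B := e
    fin_cases j <;>
      simp [evenOp, b, i, zero, hf, hff, hii, hcl, -closure_sdiff_interior]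
  rw [hset]
  have := cell_spec A x
  fin_cases j <;> rcases this with h | h | h | h | h | h | h | h | h | h | h | h | h | h | h | h <;>
    (obtain ⟨h0, h1, h2, h3, h4, h5, h6, h7, h8⟩ := h
     simp [evenMask, *, Nat.testBit_eq_decide_div_mod_eq, -closure_sdiff_interior])

theorem mem_wordOp_iff (w : Bool × Fin 17) (x : X) :
    x ∈ wordOp X w A ↔ (wordMask w).testBit (cell A x) = true := by
  obtain ⟨s, j⟩ := w
  cases s with
  | false => exact mem_evenOp_iff j x
  | true =>
    -- Subtracting from sixteen ones never borrows, so it flips each bit.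
    have h : ∀ j : Fin 17, ∀ c < 16,
        (65535 - evenMask j).testBit c = !(evenMask j).testBit c := by decide
    have h1 : x ∈ wordOp X (true, j) A ↔ x ∉ evenOp X j A := Iff.rfl
    rw [h1, mem_evenOp_iff, wordMask, cond_true, h j _ (cell_lt A x)]
    simp

variable (A) in
/-- The set of nonempty cells of a subset. -/
def cells : Set ℕ := Set.range (cell A)

variable (X) in
/-- The set of cells that are nonempty for some subset. -/
def allCells : Set ℕ := ⋃ A : Set X, cells A

theorem cells_subset_allCells : cells A ⊆ allCells X := Set.subset_iUnion cells A

theorem cells_lt : ∀ j ∈ cells A, j < 16 := by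
  rintro _ ⟨x, rfl⟩; exact cell_lt A x

theorem allCells_lt : ∀ j ∈ allCells X, j < 16 := fun j hj => by
  obtain ⟨A, hA⟩ := Set.mem_iUnion.1 hj
  exact cells_lt j hA

theorem wordOp_apply_eq_iff (w w' : Bool × Fin 17) : wordOp X w A = wordOp X w' A ↔
    wordMask w &&& bits (cells A) = wordMask w' &&& bits (cells A) := by
  rw [and_bits_eq_iff _ cells_lt, Set.ext_iff]
  simp only [mem_wordOp_iff, cells, Set.forall_mem_range, ← Bool.eq_iff_iff]

theorem wordOp_eq_iff (w w' : Bool × Fin 17) : wordOp X w = wordOp X w' ↔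
    wordMask w &&& bits (allCells X) = wordMask w' &&& bits (allCells X) := by
  rw [and_bits_eq_iff _ allCells_lt, funext_iff]
  simp only [Set.ext_iff, mem_wordOp_iff, allCells, cells, Set.mem_iUnion, Set.mem_range,
    ← Bool.eq_iff_iff]
  constructor
  · rintro h _ ⟨A, x, rfl⟩; exact h A x
  · exact fun h A x => h _ ⟨A, x, rfl⟩

theorem kOf_eq_kBits (A : Set X) : kOf A = kBits (bits (cells A)) := by
  rw [kOf_eq_ncard, ncard_values_eq_countDistinct kWords _
    (fun w => wordMask w &&& bits (cells A)) fun w _ w' _ => wordOp_apply_eq_iff w w',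
    kBits, countBits_zero, ← map_wordMask_kWords, List.map_map]
  rfl

theorem kfOf_eq_kfBits (A : Set X) : kfOf A = kfBits (bits (cells A)) := by
  rw [kfOf_eq_ncard, ncard_values_eq_countDistinct kfWords _
    (fun w => wordMask w &&& bits (cells A)) fun w _ w' _ => wordOp_apply_eq_iff w w',
    kfBits, countBits_zero, ← map_wordMask_kfWords, List.map_map]
  rfl

variable (X) in
theorem KNumber_eq_kBits : KNumber X = kBits (bits (allCells X)) := by
  rw [KNumber, K_eq, ncard_values_eq_countDistinct kWords _
    (fun w => wordMask w &&& bits (allCells X)) fun w _ w' _ => wordOp_eq_iff w w',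
    kBits, countBits_zero, ← map_wordMask_kWords, List.map_map]
  rfl

variable (X) in
theorem KfNumber_eq_kfBits : KfNumber X = kfBits (bits (allCells X)) := by
  rw [KfNumber, KF_eq, ncard_values_eq_countDistinct kfWords _
    (fun w => wordMask w &&& bits (allCells X)) fun w _ w' _ => wordOp_eq_iff w w',
    kfBits, countBits_zero, ← map_wordMask_kfWords, List.map_map]
  rfl

/-! ### Which cells are nonempty -/

theorem zero_mem_cells {x : X} (h : x ∈ interior A) : 0 ∈ cells A := by
  refine ⟨x, ?_⟩
  have := cell_spec A x
  simp only [h, not_true_eq_false, false_and, and_false, or_false] at this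
  exact this.1

theorem one_mem_cells {x : X} (h : x ∉ closure A) : 1 ∈ cells A := by
  refine ⟨x, ?_⟩
  have := cell_spec A x
  simp only [h, false_and, and_false, or_false, false_or] at this
  exact this.1

theorem two_mem_cells {x : X} (h : x ∈ interior (closure (interior A))) (h' : x ∉ A) :
    2 ∈ cells A := by
  refine ⟨x, ?_⟩
  have := cell_spec A x
  simp only [h, h', not_true_eq_false, false_and, and_false, or_false, false_or] at this
  exact this.1

theorem five_mem_cells {x : X} (h' : x ∉ closure (interior (closure A)))
    (hA : x ∈ A) : 5 ∈ cells A := by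
  refine ⟨x, ?_⟩
  have := cell_spec A x
  simp only [h', hA, not_true_eq_false, false_and, and_false, or_false, false_or] at this
  exact this.1

-- On the open set `ib A \ bi A` both `A` and its complement are dense, so one point of region four
-- forces both halves to be nonempty.
open Classical in
theorem six_mem_cells_and {x : X} (h : x ∈ interior (closure A)) (h' : x ∉ closure (interior A)) :
    6 ∈ cells A ∧ 7 ∈ cells A := by
  have hU : IsOpen (interior (closure A) \ closure (interior A)) :=
    isOpen_interior.sdiff isClosed_closure
  have key : ∀ y ∈ interior (closure A) \ closure (interior A),
      cell A y = if y ∈ A then 7 else 6 := by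
    rintro y ⟨hy, hy'⟩
    have := cell_spec A y
    simp only [hy, hy', not_true_eq_false, false_and, and_false, or_false, false_or] at this
    rcases this with h | h
    · rw [h.1, if_neg h.2.2.1]
    · rw [h.1, if_pos h.2.2.1]
  constructor
  · by_contra hne
    have hsub : interior (closure A) \ closure (interior A) ⊆ A := fun y hy => by
      by_contra hyA
      exact hne ⟨y, by rw [key y hy, if_neg hyA]⟩
    exact h' (subset_closure (interior_maximal hsub hU ⟨h, h'⟩))
  · obtain ⟨y, hy, hyA⟩ := mem_closure_iff.1 (interior_subset h) _ hU ⟨h, h'⟩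
    exact ⟨y, by rw [key y hy, if_pos hyA]⟩

theorem three_mem_cells {x : X} (h : x ∈ interior (closure A)) (h' : x ∈ closure (interior A))
    (h'' : x ∉ interior (closure (interior A))) : 8 ∈ cells A ∨ 9 ∈ cells A := by
  have := cell_spec A x
  simp only [h, h', h'', not_true_eq_false, false_and, and_false, or_false, false_or] at this
  rcases this with h | h
  · exact Or.inl ⟨x, h.1⟩
  · exact Or.inr ⟨x, h.1⟩

/-- The set of cells of a subset of a nonempty space satisfies the closure conditions. -/
theorem isPattern_cells [Nonempty X] (A : Set X) : IsPattern (cells A) := by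
  have h0 : (closure (interior A)).Nonempty → 0 ∈ cells A := fun h => by
    obtain ⟨y, hy⟩ := closure_nonempty_iff.1 h
    exact zero_mem_cells hy
  have h1 : ∀ x, x ∉ interior (closure A) → 1 ∈ cells A := fun x hx => by
    by_contra hne
    have : closure A = Set.univ := Set.eq_univ_of_forall fun y => by
      by_contra hy; exact hne (one_mem_cells hy)
    rw [this, interior_univ] at hx
    exact hx trivial
  have h6 : (closure (interior (closure A) \ closure (interior A))).Nonempty →
      6 ∈ cells A ∧ 7 ∈ cells A := fun h => by
    obtain ⟨y, hy⟩ := closure_nonempty_iff.1 h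
    exact six_mem_cells_and hy.1 hy.2
  refine ⟨cells_lt, Set.range_nonempty _, ?_, ?_, ?_, ?_, ?_, ?_, ?_, ?_, ?_⟩
  · rintro ⟨x, hx⟩
    have := cell_spec A x
    simp [hx] at this
    exact h0 ⟨x, this.2.2.2.2.1⟩
  · rintro ⟨x, hx⟩
    have := cell_spec A x
    simp [hx] at this
    by_contra hne
    -- If cell 2 were empty, the open set `ibi A` would lie in `A`, hence in its interior, leaving
    -- nothing for cell 3.
    have hsub : interior (closure (interior A)) ⊆ A := fun y hy => by
      by_contra hyA
      exact hne (two_mem_cells hy hyA)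
    exact this.1 (interior_maximal hsub isOpen_interior this.2.2.2.1)
  · rintro ⟨x, hx⟩
    have := cell_spec A x
    simp [hx] at this
    exact h1 x this.2.2.2.2.2.1
  · rintro ⟨x, hx⟩
    have := cell_spec A x
    simp [hx] at this
    -- The complement of `bib A` is a neighborhood of this closure point, so it contains points of
    -- `A`; these lie in cell 5.
    obtain ⟨y, hy, hyA⟩ := mem_closure_iff.1 this.2.2.1 _ isClosed_closure.isOpen_compl
      this.2.2.2.2.2.2.1
    exact five_mem_cells hy hyA
  · constructor
    · rintro ⟨x, hx⟩
      have := cell_spec A x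
      simp [hx] at this
      exact (six_mem_cells_and this.2.2.2.2.2.1 this.2.2.2.2.1).2
    · rintro ⟨x, hx⟩
      have := cell_spec A x
      simp [hx] at this
      exact (six_mem_cells_and this.2.2.2.2.2.1 this.2.2.2.2.1).1
  · rintro (⟨x, hx⟩ | ⟨x, hx⟩) <;>
    · have := cell_spec A x
      simp [hx] at this
      exact ⟨h0 ⟨x, this.2.2.2.2.1⟩, (h6 ⟨x, this.2.2.2.2.2.2.2⟩).1⟩
  · rintro (⟨x, hx⟩ | ⟨x, hx⟩) <;>
    · have := cell_spec A x
      simp [hx] at this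
      exact ⟨h0 ⟨x, this.2.2.2.2.1⟩, h1 x this.2.2.2.2.2.1⟩
  · rintro (⟨x, hx⟩ | ⟨x, hx⟩) <;>
    · have := cell_spec A x
      simp [hx] at this
      exact ⟨h0 ⟨x, this.2.2.2.2.1⟩, h1 x this.2.2.2.2.2.1, (h6 ⟨x, this.2.2.2.2.2.2.2⟩).1⟩
  · rintro (⟨x, hx⟩ | ⟨x, hx⟩) <;>
    · have := cell_spec A x
      simp [hx] at this
      exact ⟨h1 x this.2.2.2.2.2.1, (h6 ⟨x, this.2.2.2.2.2.2.2⟩).1⟩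

-- Each condition has a premise witnessed by a single cell, and conclusions that persist in larger
-- sets, so it passes to unions.
variable (X) in
theorem isPattern_allCells [Nonempty X] : IsPattern (allCells X) := by
  have hP := fun A : Set X => isPattern_cells A
  have up : ∀ {A : Set X} {j : ℕ}, j ∈ cells A → j ∈ allCells X := fun h =>
    cells_subset_allCells h
  have ex : ∀ {j : ℕ}, j ∈ allCells X → ∃ A : Set X, j ∈ cells A := fun h => Set.mem_iUnion.1 h
  have ex2 : ∀ {j k : ℕ}, j ∈ allCells X ∨ k ∈ allCells X →
      ∃ A : Set X, j ∈ cells A ∨ k ∈ cells A := fun h => by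
    rcases h with h | h
    · obtain ⟨A, hA⟩ := ex h; exact ⟨A, Or.inl hA⟩
    · obtain ⟨A, hA⟩ := ex h; exact ⟨A, Or.inr hA⟩
  refine ⟨allCells_lt, ?_, ?_, ?_, ?_, ?_, ⟨?_, ?_⟩, ?_, ?_, ?_, ?_⟩
  · obtain ⟨j, hj⟩ := (hP ∅).nonempty
    exact ⟨j, up hj⟩
  · intro h; obtain ⟨A, hA⟩ := ex h; exact up ((hP A).two_one hA)
  · intro h; obtain ⟨A, hA⟩ := ex h; exact up ((hP A).two' hA)
  · intro h; obtain ⟨A, hA⟩ := ex h; exact up ((hP A).eight_nine hA)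
  · intro h; obtain ⟨A, hA⟩ := ex h; exact up ((hP A).eight' hA)
  · intro h; obtain ⟨A, hA⟩ := ex h; exact up ((hP A).four.1 hA)
  · intro h; obtain ⟨A, hA⟩ := ex h; exact up ((hP A).four.2 hA)
  · intro h; obtain ⟨A, hA⟩ := ex2 h; exact ((hP A).three hA).imp up up
  · intro h; obtain ⟨A, hA⟩ := ex2 h; exact ((hP A).five hA).imp up up
  · intro h; obtain ⟨A, hA⟩ := ex2 h; exact ((hP A).six hA).imp up (And.imp up up)
  · intro h; obtain ⟨A, hA⟩ := ex2 h; exact ((hP A).seven hA).imp up up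

end Cells

section Constructions

variable {X : Type u} [TopologicalSpace X] {A B : Set X}

/-! ### Duality -/

/-- The cell of the complement. -/
def dualCell : ℕ → ℕ
  | 0 => 1 | 1 => 0 | 2 => 5 | 3 => 4 | 4 => 3 | 5 => 2 | 6 => 7 | 7 => 6
  | 8 => 15 | 9 => 14 | 10 => 11 | 11 => 10 | 12 => 13 | 13 => 12 | 14 => 9 | 15 => 8
  | n => n

/-- Complementation swaps closures with interiors and leaves the set `ib A \ bi A` unchanged. It
interchanges regions three and seven. -/
theorem cell_compl (A : Set X) (x : X) : cell Aᶜ x = dualCell (cell A x) := by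
  have h' := cell_spec Aᶜ x
  have hset : (closure (interior A))ᶜ \ (interior (closure A))ᶜ =
      interior (closure A) \ closure (interior A) := by
    ext y; simp only [Set.mem_sdiff, Set.mem_compl_iff, not_not]; tauto
  simp only [interior_compl, closure_compl, hset, Set.mem_compl_iff, not_not] at h'
  rcases cell_spec A x with h | h | h | h | h | h | h | h | h | h | h | h | h | h | h | h <;>
    (obtain ⟨h0, h1, h2, h3, h4, h5, h6, h7, h8⟩ := h
     simp only [h1, h2, h3, h4, h5, h6, h7, h8, not_true_eq_false, not_false_eq_true,
      and_false, or_false, false_or, and_true] at h'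
     rw [h0, h']
     rfl)

theorem dualCell_mem_cells_compl {j : ℕ} (h : j ∈ cells A) : dualCell j ∈ cells Aᶜ := by
  obtain ⟨x, rfl⟩ := h
  exact ⟨x, cell_compl A x⟩

/-! ### Locality -/

theorem mem_closure_congr {C : Set X} (hC : IsOpen C) (h : ∀ y ∈ C, y ∈ A ↔ y ∈ B) :
    ∀ y ∈ C, y ∈ closure A ↔ y ∈ closure B := by
  have key : ∀ A B : Set X, (∀ y ∈ C, y ∈ A ↔ y ∈ B) → ∀ y ∈ C, y ∈ closure A → y ∈ closure B := by
    intro A B h y hy hyA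
    rw [mem_closure_iff] at hyA ⊢
    intro U hU hyU
    obtain ⟨z, hz, hzA⟩ := hyA _ (hU.inter hC) ⟨hyU, hy⟩
    exact ⟨z, hz.1, (h z hz.2).1 hzA⟩
  exact fun y hy => ⟨key A B h y hy, key B A (fun z hz => (h z hz).symm) y hy⟩

theorem mem_interior_congr {C : Set X} (hC : IsOpen C) (h : ∀ y ∈ C, y ∈ A ↔ y ∈ B) :
    ∀ y ∈ C, y ∈ interior A ↔ y ∈ interior B := by
  intro y hy
  have := mem_closure_congr (A := Aᶜ) (B := Bᶜ) hC (fun z hz => not_congr (h z hz)) y hy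
  rw [closure_compl, closure_compl] at this
  exact not_iff_not.1 this

/-- The cell of a point depends only on the trace of the set on an open neighborhood. -/
theorem cell_congr {C : Set X} (hC : IsOpen C) (h : ∀ y ∈ C, y ∈ A ↔ y ∈ B) {x : X} (hx : x ∈ C) :
    cell A x = cell B x := by
  have hi := mem_interior_congr hC h
  have hb := mem_closure_congr hC h
  have hbi := mem_closure_congr hC hi
  have hib := mem_interior_congr hC hb
  have hbif := mem_closure_congr (A := interior (closure A) \ closure (interior A))
    (B := interior (closure B) \ closure (interior B)) hC
    fun y hy => and_congr (hib y hy) (not_congr (hbi y hy))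
  unfold cell
  rw [propext (hi x hx), propext (hb x hx), propext (mem_interior_congr hC hbi x hx),
    propext (mem_closure_congr hC hib x hx), propext (hib x hx), propext (hbi x hx),
    propext (hbif x hx), propext (h x hx)]

/-! ### Modifications of subsets -/

/-- Adding the exterior of `A` makes the set dense, so every point enters `ib`, while `x` stays in
`bi`. Within region four of `A` nothing has changed and the new set still has empty interior there;
as `x` is a limit of that region, it is not in `ibi`. -/
theorem exists_three_of_six (h : 12 ∈ cells A ∨ 13 ∈ cells A) :
    ∃ B : Set X, 8 ∈ cells B ∨ 9 ∈ cells B := by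
  obtain ⟨x, hbi, hbif⟩ : ∃ x, x ∈ closure (interior A) ∧
      x ∈ closure (interior (closure A) \ closure (interior A)) := by
    rcases h with ⟨x, hx⟩ | ⟨x, hx⟩ <;>
    · have := cell_spec A x
      simp [hx] at this
      exact ⟨x, this.2.2.2.2.1, this.2.2.2.2.2.2.2⟩
  refine ⟨A ∪ (closure A)ᶜ, three_mem_cells (x := x) ?_ ?_ ?_⟩
  · have : closure (A ∪ (closure A)ᶜ) = Set.univ := by
      refine Set.eq_univ_of_forall fun y => ?_
      by_cases hy : y ∈ closure A
      · exact closure_mono Set.subset_union_left hy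
      · exact subset_closure (Or.inr hy)
    rw [this, interior_univ]
    trivial
  · exact closure_mono (interior_mono Set.subset_union_left) hbi
  · intro hx
    obtain ⟨y, hy, hyV⟩ := mem_closure_iff.1 hbif _ isOpen_interior hx
    have hV : IsOpen (interior (closure A) \ closure (interior A)) :=
      isOpen_interior.sdiff isClosed_closure
    obtain ⟨z, hzV, hz⟩ := mem_closure_iff.1 (interior_subset hy) _ hV hyV
    have hsub : interior (A ∪ (closure A)ᶜ) ∩ (interior (closure A) \ closure (interior A)) ⊆ A := by
      rintro w ⟨hw, hwV⟩
      rcases interior_subset hw with h | h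
      · exact h
      · exact absurd (interior_subset hwV.1) h
    exact hzV.2 (subset_closure (interior_maximal hsub (isOpen_interior.inter hV) ⟨hz, hzV⟩))

theorem exists_three_of_seven (h : 14 ∈ cells A ∨ 15 ∈ cells A) :
    ∃ B : Set X, 8 ∈ cells B ∨ 9 ∈ cells B :=
  ⟨Aᶜ, h.symm.imp dualCell_mem_cells_compl dualCell_mem_cells_compl⟩

theorem exists_seven_of_three (h : 8 ∈ cells A ∨ 9 ∈ cells A) :
    ∃ B : Set X, 14 ∈ cells B ∨ 15 ∈ cells B :=
  ⟨Aᶜ, h.symm.imp dualCell_mem_cells_compl dualCell_mem_cells_compl⟩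

open Classical in
theorem cell_of_five {x : X} (h : x ∈ closure (interior A)) (h' : x ∉ interior (closure A))
    (h'' : x ∉ closure (interior (closure A) \ closure (interior A))) :
    cell A x = if x ∈ A then 11 else 10 := by
  have := cell_spec A x
  simp only [h, h', h'', not_true_eq_false, false_and, and_false, or_false, false_or] at this
  rcases this with h | h
  · rw [h.1, if_neg h.2.2.1]
  · rw [h.1, if_pos h.2.2.1]

/-- Removing from `A` its non-interior points in `bi A` changes neither interior nor closure. Points
of cell 11 thereby move to cell 10, and points of cell 5, lying outside `bi A`, stay. -/
theorem exists_five_eight (h11 : 11 ∈ cells A) (h5 : 5 ∈ cells A) :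
    ∃ B : Set X, 10 ∈ cells B ∧ 5 ∈ cells B := by
  set B := interior A ∪ (A \ closure (interior A)) with hB
  have hBA : B ⊆ A := Set.union_subset interior_subset Set.sdiff_subset
  have hi : interior B = interior A :=
    (interior_mono hBA).antisymm (interior_maximal Set.subset_union_left isOpen_interior)
  have hb : closure B = closure A := by
    refine (closure_mono hBA).antisymm (closure_minimal (fun y hy => ?_) isClosed_closure)
    by_cases h : y ∈ closure (interior A)
    · exact closure_mono Set.subset_union_left h
    · exact subset_closure (Or.inr ⟨hy, h⟩)
  refine ⟨B, ?_, ?_⟩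
  · obtain ⟨x, hx⟩ := h11
    have := cell_spec A x
    simp [hx] at this
    refine ⟨x, ?_⟩
    rw [cell_of_five (by rw [hi]; exact this.2.2.2.2.1) (by rw [hb]; exact this.2.2.2.2.2.1)
      (by rw [hi, hb]; exact this.2.2.2.2.2.2.2), if_neg]
    rintro (h | h)
    · exact this.1 h
    · exact h.2 this.2.2.2.2.1
  · obtain ⟨x, hx⟩ := h5
    have := cell_spec A x
    simp [hx] at this
    exact five_mem_cells (x := x) (by rw [hb]; exact this.2.2.2.2.2.2.1)
      (Or.inr ⟨this.2.1, this.2.2.2.2.1⟩)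

/-! ### Spaces in which disjoint open sets, one of them resolvable, have disjoint closures -/

/-- `E` and its complement are dense in `G`. -/
def Resolves (E G : Set X) : Prop := G ⊆ closure (G ∩ E) ∧ G ⊆ closure (G \ E)

theorem Resolves.mono {E G U : Set X} (h : Resolves E G) (hU : IsOpen U) (hUG : U ⊆ G) :
    Resolves E U := by
  constructor <;> intro y hy <;> rw [mem_closure_iff] <;> intro W hW hyW
  · obtain ⟨z, hz, hzG⟩ := mem_closure_iff.1 (h.1 (hUG hy)) _ (hW.inter hU) ⟨hyW, hy⟩
    exact ⟨z, hz.1, hz.2, hzG.2⟩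
  · obtain ⟨z, hz, hzG⟩ := mem_closure_iff.1 (h.2 (hUG hy)) _ (hW.inter hU) ⟨hyW, hy⟩
    exact ⟨z, hz.1, hz.2, hzG.2⟩

theorem Resolves.closure {E V : Set X} (h : Resolves E V) : Resolves (V ∩ E) (closure V) := by
  constructor
  · refine closure_minimal (h.1.trans (closure_mono ?_)) isClosed_closure
    exact fun y hy => ⟨subset_closure hy.1, hy⟩
  · refine closure_minimal (h.2.trans (closure_mono ?_)) isClosed_closure
    exact fun y hy => ⟨subset_closure hy.1, fun hE => hy.2 hE.2⟩

theorem resolves_of_subset {E G A : Set X} (hG : IsOpen G) (h : Resolves E G)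
    (hA : ∀ y ∈ G, y ∈ A ↔ y ∈ E) : ∀ y ∈ G, y ∈ interior (closure A) ∧ y ∉ closure (interior A) := by
  intro y hy
  constructor
  · refine interior_maximal (fun z hz => ?_) hG hy
    exact closure_mono (fun w hw => (hA w hw.1).2 hw.2) (h.1 hz)
  · intro hyA
    obtain ⟨z, hzG, hz⟩ := mem_closure_iff.1 hyA G hG hy
    obtain ⟨w, hw, hwG⟩ := mem_closure_iff.1 (h.2 hzG) _ isOpen_interior hz
    exact hwG.2 ((hA w hwG.1).1 (interior_subset hw))

/-- Join the exterior `U` of `V` with the part `V ∩ E`. The result is dense and has interior `U`, so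
a common point of the closures of `U` and `V` would lie in region three. Hence these closures are
complementary. -/
theorem isOpen_closure_of_resolves
    (h3 : ∀ A : Set X, 8 ∉ cells A ∧ 9 ∉ cells A)
    {V E : Set X} (hV : IsOpen V) (h : Resolves E V) :
    IsOpen (closure V) := by
  set U := (closure V)ᶜ with hU
  have hUo : IsOpen U := isClosed_closure.isOpen_compl
  set A := U ∪ (V ∩ E) with hA
  have hi : interior A = U := by
    refine Set.Subset.antisymm (fun y hy => ?_) (interior_maximal Set.subset_union_left hUo)
    by_contra hyU
    obtain ⟨z, hz, hzV⟩ := mem_closure_iff.1 (not_not.1 hyU) _ isOpen_interior hy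
    obtain ⟨w, hw, hwV⟩ := mem_closure_iff.1 (h.2 hzV) _ isOpen_interior hz
    rcases interior_subset hw with h' | h'
    · exact h' (subset_closure hwV.1)
    · exact hwV.2 h'.2
  have hb : closure A = Set.univ := by
    refine Set.eq_univ_of_forall fun y => ?_
    by_cases hy : y ∈ closure V
    · exact closure_mono Set.subset_union_right (closure_minimal h.1 isClosed_closure hy)
    · exact subset_closure (Or.inl hy)
  have hdisj : ∀ x ∈ closure V, x ∉ closure U := by
    intro x hx hxU
    have := three_mem_cells (A := A) (x := x) (by rw [hb, interior_univ]; trivial)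
      (by rwa [hi]) ?_
    · exact this.elim (h3 A).1 (h3 A).2
    · rw [hi]
      intro hx'
      obtain ⟨y, hy, hyV⟩ := mem_closure_iff.1 hx _ isOpen_interior hx'
      obtain ⟨z, hzV, hzU⟩ := mem_closure_iff.1 (interior_subset hy) V hV hyV
      exact hzU (subset_closure hzV)
  have heq : closure V = (closure U)ᶜ := by
    ext x
    refine ⟨hdisj x, fun hx => ?_⟩
    by_contra hxV
    exact hx (subset_closure hxV)
  rw [heq]
  exact isClosed_closure.isOpen_compl

/-- The closure of `V` is open, so a common closure point would make it meet `U`, and then `U` would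
meet `V`. -/
theorem disjoint_closure_of_resolves
    (h3 : ∀ A : Set X, 8 ∉ cells A ∧ 9 ∉ cells A)
    {U V E : Set X} (hU : IsOpen U) (hV : IsOpen V)
    (h : Resolves E V) (hd : ∀ x ∈ U, x ∉ V) : ∀ x ∈ closure U, x ∉ closure V := by
  intro x hx hxV
  obtain ⟨y, hyV, hyU⟩ := mem_closure_iff.1 hx _ (isOpen_closure_of_resolves h3 hV h) hxV
  obtain ⟨z, hzU, hzV⟩ := mem_closure_iff.1 hyV _ hU hyU
  exact hd z hzU hzV

/-- Region four of a suitable `A` is open and resolved by `A`; its closure is clopen and still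
resolvable. -/
theorem exists_isClopen_resolves
    (h3 : ∀ A : Set X, 8 ∉ cells A ∧ 9 ∉ cells A)
    (h6 : 6 ∈ allCells X) :
    ∃ G E : Set X, IsClopen G ∧ G.Nonempty ∧ Resolves E G := by
  obtain ⟨A, x, hx⟩ := Set.mem_iUnion.1 h6
  have hxs := cell_spec A x
  simp [hx] at hxs
  set V := interior (closure A) \ closure (interior A) with hV
  have hVo : IsOpen V := isOpen_interior.sdiff isClosed_closure
  have hres : Resolves A V := by
    constructor <;> intro y hy <;> rw [mem_closure_iff] <;> intro W hW hyW
    · obtain ⟨z, hz, hzA⟩ := mem_closure_iff.1 (interior_subset hy.1) _ (hW.inter hVo) ⟨hyW, hy⟩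
      exact ⟨z, hz.1, hz.2, hzA⟩
    · by_contra hne
      have hsub : W ∩ V ⊆ A := fun z hz => by
        by_contra hzA; exact hne ⟨z, hz.1, hz.2, hzA⟩
      exact hy.2 (subset_closure (interior_maximal hsub (hW.inter hVo) ⟨hyW, hy⟩))
  exact ⟨closure V, V ∩ A, ⟨isClosed_closure, isOpen_closure_of_resolves h3 hVo hres⟩,
    ⟨x, subset_closure ⟨hxs.2.2.2.2.2.1, hxs.2.2.2.2.1⟩⟩, hres.closure⟩

/-- A point of `bi A \ ib A` inside `G` would be in the closure of `iA` and also of the open set `G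
\ bA`. These are disjoint and the second is resolvable. -/
theorem notMem_of_five
    (h3 : ∀ A : Set X, 8 ∉ cells A ∧ 9 ∉ cells A)
    {E G : Set X} (hG : IsOpen G) (h : Resolves E G) {x : X}
    (hx : cell A x = 10 ∨ cell A x = 11) : x ∉ G := by
  intro hxG
  obtain ⟨hbi, hib⟩ : x ∈ closure (interior A) ∧ x ∉ interior (closure A) := by
    have := cell_spec A x
    rcases hx with hx | hx <;> simp [hx] at this <;> exact ⟨this.2.2.2.2.1, this.2.2.2.2.2.1⟩
  have hVo : IsOpen (G ∩ (closure A)ᶜ) := hG.inter isClosed_closure.isOpen_compl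
  refine disjoint_closure_of_resolves h3 isOpen_interior hVo
    (h.mono hVo Set.inter_subset_left) (fun y hy hyV => ?_) x hbi ?_
  · exact hyV.2 (subset_closure (interior_subset hy))
  · rw [mem_closure_iff]
    intro W hW hxW
    by_contra hne
    refine hib (mem_interior.2 ⟨W ∩ G, fun y hy => ?_, hW.inter hG, hxW, hxG⟩)
    by_contra hyA
    exact hne ⟨y, hy.1, hy.2, hyA⟩

theorem cells_modification {E G : Set X} (hG : IsClopen G) (hne : G.Nonempty) (h : Resolves E G) :
    6 ∈ cells ((A \ G) ∪ (G ∩ E)) ∧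
      ∀ x ∉ G, cell ((A \ G) ∪ (G ∩ E)) x = cell A x := by
  constructor
  · obtain ⟨x, hx⟩ := hne
    have := resolves_of_subset (A := (A \ G) ∪ (G ∩ E)) hG.isOpen h
      (fun y hy => by simp [hy]) x hx
    exact (six_mem_cells_and this.1 this.2).1
  · intro x hx
    exact cell_congr hG.isClosed.isOpen_compl
      (fun y (hy : y ∉ G) => by simp [hy]) hx

/-- Replacing `A` by the resolving set on the clopen `G` creates region four inside `G`. Region five
lies outside `G`, where cells are unaffected. -/
theorem exists_four_five
    (h3 : ∀ A : Set X, 8 ∉ cells A ∧ 9 ∉ cells A)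
    (h6 : 6 ∈ allCells X) (h5 : 10 ∈ cells A ∨ 11 ∈ cells A) :
    ∃ B : Set X, 6 ∈ cells B ∧ (10 ∈ cells B ∨ 11 ∈ cells B) := by
  obtain ⟨G, E, hG, hne, h⟩ := exists_isClopen_resolves h3 h6
  obtain ⟨h4, hc⟩ := cells_modification (A := A) hG hne h
  refine ⟨_, h4, h5.imp ?_ ?_⟩ <;> rintro ⟨x, hx⟩
  · exact ⟨x, (hc x (notMem_of_five h3 hG.isOpen h (Or.inl hx))).trans hx⟩
  · exact ⟨x, (hc x (notMem_of_five h3 hG.isOpen h (Or.inr hx))).trans hx⟩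

theorem exists_four_five_two_or_eight
    (h3 : ∀ A : Set X, 8 ∉ cells A ∧ 9 ∉ cells A)
    (h6 : 6 ∈ allCells X) (h5 : 10 ∈ cells A ∨ 11 ∈ cells A)
    (h2 : 2 ∈ cells A) (h8 : 5 ∈ cells A) :
    ∃ B : Set X, 6 ∈ cells B ∧ (10 ∈ cells B ∨ 11 ∈ cells B) ∧ (2 ∈ cells B ∨ 5 ∈ cells B) := by
  obtain ⟨G, E, hG, hne, h⟩ := exists_isClopen_resolves h3 h6
  have key : ∀ G' : Set X, IsClopen G' → G'.Nonempty → Resolves E G' →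
      ((∃ x ∉ G', cell A x = 2) ∨ (∃ x ∉ G', cell A x = 5)) →
      ∃ B : Set X, 6 ∈ cells B ∧ (10 ∈ cells B ∨ 11 ∈ cells B) ∧ (2 ∈ cells B ∨ 5 ∈ cells B) := by
    intro G' hG' hne' h' hx
    obtain ⟨h4, hc⟩ := cells_modification (A := A) hG' hne' h'
    refine ⟨_, h4, h5.imp ?_ ?_, hx.imp ?_ ?_⟩
    · rintro ⟨x, hx⟩
      exact ⟨x, (hc x (notMem_of_five h3 hG'.isOpen h' (Or.inl hx))).trans hx⟩
    · rintro ⟨x, hx⟩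
      exact ⟨x, (hc x (notMem_of_five h3 hG'.isOpen h' (Or.inr hx))).trans hx⟩
    · rintro ⟨x, hxG, hx⟩; exact ⟨x, (hc x hxG).trans hx⟩
    · rintro ⟨x, hxG, hx⟩; exact ⟨x, (hc x hxG).trans hx⟩
  -- The clopen set must miss a point of cell 2 or of cell 5. The former lies in `bi A`, the latter
  -- outside: if `G ⊆ bi A`, cell 5 survives; otherwise `G \ bi A` is used, which is again clopen
  -- because closures of disjoint open sets separate, and cell 2 survives.
  by_cases hsub : G ⊆ closure (interior A)
  · obtain ⟨x, hx⟩ := h8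
    have := cell_spec A x
    simp [hx] at this
    exact key G hG hne h (Or.inr ⟨x, fun hxG => this.2.2.2.2.1 (hsub hxG), hx⟩)
  · obtain ⟨y, hyG, hy⟩ := Set.not_subset.1 hsub
    have hGo : IsOpen (G \ closure (interior A)) := hG.isOpen.sdiff isClosed_closure
    have hr : Resolves E (G \ closure (interior A)) := h.mono hGo Set.sdiff_subset
    have hcl : IsClosed (G \ closure (interior A)) := by
      refine isClosed_of_closure_subset fun z hz => ⟨?_, fun hz' => ?_⟩
      · exact closure_minimal Set.sdiff_subset hG.isClosed hz
      · exact disjoint_closure_of_resolves h3 isOpen_interior hGo hr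
          (fun w hw hw' => hw'.2 (subset_closure hw)) z hz' hz
    obtain ⟨x, hx⟩ := h2
    have := cell_spec A x
    simp [hx] at this
    exact key _ ⟨hcl, hGo⟩ ⟨y, hyG, hy⟩ hr (Or.inl ⟨x, fun hxG => hxG.2 this.2.2.2.2.1, hx⟩)

end Constructions

/-! ### Finite spaces given by bit masks -/

/-- The finite space whose points are the indices of a list of bit masks. -/
def FinSpace (c : List ℕ) : Type u := ULift.{u} (Fin c.length)

/-- The topology in which the mask with index `k` describes the closure of the point `k`. -/
instance (c : List ℕ) : TopologicalSpace (FinSpace.{u} c) where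
  IsOpen U := ∀ x y : FinSpace.{u} c, (c.getD y.down 0).testBit x.down = true → x ∈ U → y ∈ U
  isOpen_univ _ _ _ _ := trivial
  isOpen_inter _ _ hU hV x y h hx := ⟨hU x y h hx.1, hV x y h hx.2⟩
  isOpen_sUnion _ hS x y h := fun ⟨U, hU, hx⟩ => ⟨U, hU, hS U hU x y h hx⟩

/-- The union of the masks of a list whose index is a bit of `m`. -/
noncomputable def unionMask (c : List ℕ) : ℕ → ℕ :=
  List.rec (fun _ => 0) (fun x _ ih m =>
    Bool.rec (ih (Nat.div m 2)) (Nat.lor x (ih (Nat.div m 2))) (Nat.beq 1 (Nat.mod m 2))) c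

theorem unionMask_cons (x : ℕ) (c : List ℕ) (m : ℕ) :
    unionMask (x :: c) m =
      bif m.testBit 0 then x ||| unionMask c (m / 2) else unionMask c (m / 2) := by
  have h : Nat.beq 1 (Nat.mod m 2) = m.testBit 0 := by
    rw [Nat.testBit_zero, Bool.eq_iff_iff, Nat.beq_eq, decide_eq_true_iff, eq_comm]
    rfl
  have h2 : ∀ (p q : ℕ) (t : Bool), Bool.rec (motive := fun _ => ℕ) p q t = bif t then q else p := by
    rintro p q ⟨⟩ <;> rfl
  rw [← h]
  exact h2 _ _ _

theorem testBit_unionMask (c : List ℕ) (m j : ℕ) : (unionMask c m).testBit j = true ↔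
    ∃ k < c.length, m.testBit k = true ∧ (c.getD k 0).testBit j = true := by
  induction c generalizing m with
  | nil => simp [unionMask]
  | cons x c ih =>
    have hsplit : (∃ k < (x :: c).length, m.testBit k = true ∧
        ((x :: c).getD k 0).testBit j = true) ↔ (m.testBit 0 = true ∧ x.testBit j = true) ∨
        ∃ k < c.length, (m / 2).testBit k = true ∧ (c.getD k 0).testBit j = true := by
      constructor
      · rintro ⟨k, hk, h1, h2⟩
        cases k with
        | zero => exact Or.inl ⟨h1, h2⟩
        | succ k => exact Or.inr ⟨k, by simpa using hk, by rwa [Nat.testBit_succ] at h1, h2⟩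
      · rintro (⟨h1, h2⟩ | ⟨k, hk, h1, h2⟩)
        · exact ⟨0, by simp, h1, h2⟩
        · exact ⟨k + 1, by simpa using hk, by rwa [Nat.testBit_succ], h2⟩
    rw [unionMask_cons, hsplit, ← ih]
    cases h : m.testBit 0 <;> simp [Nat.testBit_or]

/-- The complement of a mask. -/
def complMask (c : List ℕ) (m : ℕ) : ℕ := Nat.xor (Nat.sub (Nat.pow 2 c.length) 1) m

/-- The interior of a mask. -/
noncomputable def interiorMask (c : List ℕ) (m : ℕ) : ℕ :=
  complMask c (unionMask c (complMask c m))

/-- The boundary of a mask. -/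
noncomputable def frontierMask (c : List ℕ) (m : ℕ) : ℕ :=
  Nat.land (unionMask c m) (unionMask c (complMask c m))

/-- The masks describe the point closures of a topology. -/
noncomputable def validMasks (c : List ℕ) : Bool :=
  (List.range c.length).all fun k => (c.getD k 0).testBit k &&
    (Nat.beq (unionMask c (c.getD k 0)) (c.getD k 0) && Nat.blt (c.getD k 0) (2 ^ c.length))

section FinSpace

variable {c : List ℕ}

/-- The mask of a subset. -/
noncomputable def maskOf (A : Set (FinSpace.{u} c)) : ℕ := by
  classical exact Nat.ofBits fun j : Fin c.length => decide (ULift.up j ∈ A)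

theorem testBit_maskOf (A : Set (FinSpace.{u} c)) (x : FinSpace.{u} c) :
    (maskOf A).testBit x.down = true ↔ x ∈ A := by
  simp only [maskOf, Nat.testBit_ofBits_lt _ _ x.down.isLt, decide_eq_true_eq]
  rfl

theorem testBit_maskOf_ge (A : Set (FinSpace.{u} c)) {j : ℕ} (hj : c.length ≤ j) :
    (maskOf A).testBit j = false := by
  rw [maskOf, Nat.testBit_ofBits_ge _ _ hj]

theorem maskOf_lt (A : Set (FinSpace.{u} c)) : maskOf A < 2 ^ c.length :=
  Nat.ofBits_lt_two_pow _

theorem maskOf_eq_of_forall {A : Set (FinSpace.{u} c)} {m : ℕ} (hm : m < 2 ^ c.length)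
    (h : ∀ x : FinSpace.{u} c, x ∈ A ↔ m.testBit x.down = true) : maskOf A = m := by
  refine Nat.eq_of_testBit_eq fun j => ?_
  rcases lt_or_ge j c.length with hj | hj
  · rw [Bool.eq_iff_iff]
    exact (testBit_maskOf A ⟨⟨j, hj⟩⟩).trans (h ⟨⟨j, hj⟩⟩)
  · rw [testBit_maskOf_ge A hj, Nat.testBit_lt_two_pow (hm.trans_le
      (Nat.pow_le_pow_right (by norm_num) hj))]

theorem maskOf_inj {A B : Set (FinSpace.{u} c)} : A = B ↔ maskOf A = maskOf B := by
  refine ⟨fun h => by rw [h], fun h => ?_⟩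
  ext x
  rw [← testBit_maskOf, h, testBit_maskOf]

theorem exists_maskOf_eq {m : ℕ} (hm : m < 2 ^ c.length) :
    ∃ A : Set (FinSpace.{u} c), maskOf A = m :=
  ⟨{x | m.testBit x.down = true}, maskOf_eq_of_forall hm fun _ => Iff.rfl⟩

theorem maskOf_compl (A : Set (FinSpace.{u} c)) : maskOf Aᶜ = complMask c (maskOf A) := by
  have h : complMask c (maskOf A) = (2 ^ c.length - 1) ^^^ maskOf A := rfl
  rw [h]
  refine maskOf_eq_of_forall (Nat.xor_lt_two_pow (by
    have := Nat.two_pow_pos c.length; omega) (maskOf_lt A)) fun x => ?_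
  rw [Nat.testBit_xor, Nat.testBit_two_pow_sub_one, decide_eq_true x.down.isLt, Set.mem_compl_iff,
    ← testBit_maskOf]
  simp

/-- Valid masks encode a reflexive and transitive relation. Transitivity makes the union of the
point closures closed. -/
theorem closure_finSpace (hc : validMasks c = true) (A : Set (FinSpace.{u} c)) :
    closure A = {x | ∃ y ∈ A, (c.getD y.down 0).testBit x.down = true} := by
  have hv : ∀ k < c.length, (c.getD k 0).testBit k = true ∧
      unionMask c (c.getD k 0) = c.getD k 0 := fun k hk => by
    have := List.all_eq_true.1 hc k (List.mem_range.2 hk)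
    simp only [Bool.and_eq_true, Nat.beq_eq] at this
    exact ⟨this.1, this.2.1⟩
  refine Set.Subset.antisymm (closure_minimal (fun x hx => ⟨x, hx, (hv _ x.down.isLt).1⟩) ?_) ?_
  · rw [← isOpen_compl_iff]
    intro x y hxy hx hy
    obtain ⟨z, hz, hzy⟩ := hy
    refine hx ⟨z, hz, ?_⟩
    rw [← (hv _ z.down.isLt).2, testBit_unionMask]
    exact ⟨y.down, y.down.isLt, hzy, hxy⟩
  · rintro x ⟨y, hy, hyx⟩
    rw [mem_closure_iff]
    exact fun U hU hxU => ⟨y, hU x y hyx hxU, hy⟩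

theorem maskOf_closure (hc : validMasks c = true) (A : Set (FinSpace.{u} c)) :
    maskOf (closure A) = unionMask c (maskOf A) := by
  have hlt : unionMask c (maskOf A) < 2 ^ c.length := by
    refine Nat.lt_pow_two_of_testBit _ fun j hj => Bool.eq_false_iff.2 fun h => ?_
    obtain ⟨k, hk, -, hkj⟩ := (testBit_unionMask c _ j).1 h
    have := List.all_eq_true.1 hc k (List.mem_range.2 hk)
    simp only [Bool.and_eq_true, Nat.blt_eq] at this
    rw [Nat.testBit_lt_two_pow (this.2.2.trans_le (Nat.pow_le_pow_right (by norm_num) hj))] at hkj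
    exact Bool.false_ne_true hkj
  refine maskOf_eq_of_forall hlt fun x => ?_
  rw [closure_finSpace hc, testBit_unionMask]
  constructor
  · rintro ⟨y, hy, hyx⟩
    exact ⟨y.down, y.down.isLt, (testBit_maskOf A y).2 hy, hyx⟩
  · rintro ⟨k, hk, hkA, hkx⟩
    exact ⟨⟨⟨k, hk⟩⟩, (testBit_maskOf A ⟨⟨k, hk⟩⟩).1 hkA, hkx⟩

theorem maskOf_interior (hc : validMasks c = true) (A : Set (FinSpace.{u} c)) :
    maskOf (interior A) = interiorMask c (maskOf A) := by
  rw [interior_eq_compl_closure_compl, maskOf_compl, maskOf_closure hc, maskOf_compl]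
  rfl

theorem maskOf_boundary (hc : validMasks c = true) (A : Set (FinSpace.{u} c)) :
    maskOf (f _ A) = frontierMask c (maskOf A) := by
  have h : frontierMask c (maskOf A) = maskOf (closure A) &&& maskOf (closure Aᶜ) := by
    rw [maskOf_closure hc, maskOf_closure hc, maskOf_compl]
    rfl
  rw [h]
  refine maskOf_eq_of_forall (lt_of_le_of_lt Nat.and_le_left (maskOf_lt _)) fun x => ?_
  rw [Nat.testBit_and, Bool.and_eq_true, testBit_maskOf, testBit_maskOf]
  rfl

end FinSpace

/-! ### Computing the numbers of a finite space -/

/-- The even operators of the Kuratowski monoid on masks. -/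
noncomputable def evenKMaskOps (c : List ℕ) : List (ℕ → ℕ) :=
  [fun m => m, unionMask c, interiorMask c, fun m => unionMask c (interiorMask c m),
    fun m => interiorMask c (unionMask c m),
    fun m => unionMask c (interiorMask c (unionMask c m)),
    fun m => interiorMask c (unionMask c (interiorMask c m))]

/-- The even operators that involve the boundary, on masks. -/
noncomputable def evenFMaskOps (c : List ℕ) : List (ℕ → ℕ) :=
  [fun _ => 0, frontierMask c, fun m => interiorMask c (frontierMask c m),
    fun m => frontierMask c (interiorMask c (frontierMask c m)),
    fun m => unionMask c (interiorMask c (frontierMask c m)),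
    fun m => frontierMask c (frontierMask c m),
    fun m => frontierMask c (unionMask c m), fun m => frontierMask c (interiorMask c m),
    fun m => frontierMask c (unionMask c (interiorMask c m)),
    fun m => frontierMask c (interiorMask c (unionMask c m))]

/-- The operators of the Kuratowski monoid on masks. -/
noncomputable def kMaskOps (c : List ℕ) : List (ℕ → ℕ) :=
  evenKMaskOps c ++ (evenKMaskOps c).map fun g m => complMask c (g m)

/-- The operators of the Gaida–Eremenko monoid on masks. -/
noncomputable def kfMaskOps (c : List ℕ) : List (ℕ → ℕ) :=
  (evenKMaskOps c ++ evenFMaskOps c) ++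
    (evenKMaskOps c ++ evenFMaskOps c).map fun g m => complMask c (g m)

/-- An operator on masks, encoded as a number. -/
noncomputable def opCode (c : List ℕ) (g : ℕ → ℕ) : ℕ :=
  (List.range (2 ^ c.length)).foldr
    (fun m acc => Nat.add (g m) (Nat.mul (Nat.pow 2 c.length) acc)) 0

theorem opCode_eq_ofDigits (c : List ℕ) (g : ℕ → ℕ) :
    opCode c g = Nat.ofDigits (2 ^ c.length) ((List.range (2 ^ c.length)).map g) := by
  unfold opCode
  induction List.range (2 ^ c.length) with
  | nil => rfl
  | cons m l ih =>
    rw [List.foldr_cons, ih, List.map_cons, Nat.ofDigits_cons]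
    rfl

/-- The code lists the values as digits in base `2 ^ c.length`. The bounds make them genuine digits,
and nonemptiness of `c` makes the base exceed 1. -/
theorem opCode_eq_iff {c : List ℕ} (hne : c ≠ []) {g h : ℕ → ℕ}
    (hg : ∀ m < 2 ^ c.length, g m < 2 ^ c.length) (hh : ∀ m < 2 ^ c.length, h m < 2 ^ c.length) :
    opCode c g = opCode c h ↔ ∀ m < 2 ^ c.length, g m = h m := by
  rw [opCode_eq_ofDigits, opCode_eq_ofDigits]
  constructor
  · intro heq m hm
    have := Nat.ofDigits_inj_of_len_eq
      (Nat.one_lt_two_pow (by simpa using hne)) (by simp)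
      (by simpa using hg) (by simpa using hh) heq
    exact List.map_inj_left.1 this m (List.mem_range.2 hm)
  · intro heq
    congr 1
    exact List.map_inj_left.2 fun m hm => heq m (List.mem_range.1 hm)

section FinSpace

/-- The operation on masks that belongs to an even operator. -/
noncomputable def evenMaskOp (c : List ℕ) : Fin 17 → ℕ → ℕ :=
  ![fun m => m, unionMask c, interiorMask c, fun m => unionMask c (interiorMask c m),
    fun m => interiorMask c (unionMask c m),
    fun m => unionMask c (interiorMask c (unionMask c m)),
    fun m => interiorMask c (unionMask c (interiorMask c m)),
    fun _ => 0, frontierMask c, fun m => interiorMask c (frontierMask c m),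
    fun m => frontierMask c (interiorMask c (frontierMask c m)),
    fun m => unionMask c (interiorMask c (frontierMask c m)),
    fun m => frontierMask c (frontierMask c m),
    fun m => frontierMask c (unionMask c m), fun m => frontierMask c (interiorMask c m),
    fun m => frontierMask c (unionMask c (interiorMask c m)),
    fun m => frontierMask c (interiorMask c (unionMask c m))]

/-- The operation on masks that belongs to a word. -/
noncomputable def wordMaskOp (c : List ℕ) (w : Bool × Fin 17) : ℕ → ℕ :=
  bif w.1 then fun m => complMask c (evenMaskOp c w.2 m) else evenMaskOp c w.2

theorem map_wordMaskOp_kWords (c : List ℕ) : kWords.map (wordMaskOp c) = kMaskOps c := rfl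

theorem map_wordMaskOp_kfWords (c : List ℕ) : kfWords.map (wordMaskOp c) = kfMaskOps c := rfl

variable {c : List ℕ}

theorem maskOf_wordOp (hc : validMasks c = true) (w : Bool × Fin 17) (A : Set (FinSpace.{u} c)) :
    maskOf (wordOp _ w A) = wordMaskOp c w (maskOf A) := by
  have heven : ∀ j, maskOf (evenOp _ j A) = evenMaskOp c j (maskOf A) := by
    have h0 : maskOf (∅ : Set (FinSpace.{u} c)) = 0 :=
      maskOf_eq_of_forall (Nat.two_pow_pos _) (by simp)
    intro j
    fin_cases j <;>
      simp [evenOp, evenMaskOp, b, i, zero, h0, maskOf_closure hc, maskOf_interior hc,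
        maskOf_boundary hc]
  obtain ⟨s, j⟩ := w
  cases s with
  | false => exact heven j
  | true => exact (maskOf_compl _).trans (congrArg (complMask c) (heven j))

theorem wordMaskOp_lt (hc : validMasks c = true) (w : Bool × Fin 17) :
    ∀ m < 2 ^ c.length, wordMaskOp c w m < 2 ^ c.length := by
  intro m hm
  -- The claim about masks involves no universe, so any level serves for the auxiliary subset.
  obtain ⟨A, rfl⟩ := exists_maskOf_eq.{0} hm
  rw [← maskOf_wordOp hc]
  exact maskOf_lt _

theorem wordOp_eq_iff_opCode (hc : validMasks c = true) (hne : c ≠ []) (w w' : Bool × Fin 17) :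
    wordOp (FinSpace.{u} c) w = wordOp (FinSpace.{u} c) w' ↔
      opCode c (wordMaskOp c w) = opCode c (wordMaskOp c w') := by
  rw [opCode_eq_iff hne (wordMaskOp_lt hc w) (wordMaskOp_lt hc w'), funext_iff]
  constructor
  · intro h m hm
    obtain ⟨A, rfl⟩ := exists_maskOf_eq.{u} hm
    rw [← maskOf_wordOp hc, ← maskOf_wordOp hc, h]
  · intro h A
    rw [maskOf_inj, maskOf_wordOp hc, maskOf_wordOp hc, h _ (maskOf_lt A)]

/-- The `k`-number of the subset with a given mask. -/
noncomputable def kCount (c : List ℕ) (m : ℕ) : ℕ := countBits (fun g : ℕ → ℕ => g m) (kMaskOps c) 0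

/-- The `k_f`-number of the subset with a given mask. -/
noncomputable def kfCount (c : List ℕ) (m : ℕ) : ℕ :=
  countBits (fun g : ℕ → ℕ => g m) (kfMaskOps c) 0

theorem kOf_eq_kCount (hc : validMasks c = true) (A : Set (FinSpace.{u} c)) :
    kOf A = kCount c (maskOf A) := by
  rw [kOf_eq_ncard, ncard_values_eq_countDistinct kWords _
    (fun w => wordMaskOp c w (maskOf A)) fun w _ w' _ => by
      rw [maskOf_inj, maskOf_wordOp hc, maskOf_wordOp hc],
    kCount, countBits_zero, ← map_wordMaskOp_kWords, List.map_map]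
  rfl

theorem kfOf_eq_kfCount (hc : validMasks c = true) (A : Set (FinSpace.{u} c)) :
    kfOf A = kfCount c (maskOf A) := by
  rw [kfOf_eq_ncard, ncard_values_eq_countDistinct kfWords _
    (fun w => wordMaskOp c w (maskOf A)) fun w _ w' _ => by
      rw [maskOf_inj, maskOf_wordOp hc, maskOf_wordOp hc],
    kfCount, countBits_zero, ← map_wordMaskOp_kfWords, List.map_map]
  rfl

theorem KNumber_finSpace (hc : validMasks c = true) (hne : c ≠ []) :
    KNumber (FinSpace.{u} c) = countDistinct ((kMaskOps c).map (opCode c)) := by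
  rw [KNumber, K_eq, ncard_values_eq_countDistinct kWords _ (fun w => opCode c (wordMaskOp c w))
    fun w _ w' _ => wordOp_eq_iff_opCode hc hne w w', ← map_wordMaskOp_kWords, List.map_map]
  rfl

theorem KfNumber_finSpace (hc : validMasks c = true) (hne : c ≠ []) :
    KfNumber (FinSpace.{u} c) = countDistinct ((kfMaskOps c).map (opCode c)) := by
  rw [KfNumber, KF_eq, ncard_values_eq_countDistinct kfWords _
    (fun w => opCode c (wordMaskOp c w)) fun w _ w' _ => wordOp_eq_iff_opCode hc hne w w',
    ← map_wordMaskOp_kfWords, List.map_map]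
  rfl

/-- Test that a count has maximum `v`, attained at `m`. -/
def maxCheck (c : List ℕ) (count : ℕ → ℕ) (m v : ℕ) : Bool :=
  Nat.blt m (2 ^ c.length) && (Nat.beq (count m) v &&
    (List.range (2 ^ c.length)).all fun m' => Nat.ble (count m') v)

theorem sSup_eq_of_maxCheck {φ : Set (FinSpace.{u} c) → ℕ} {count : ℕ → ℕ}
    (hφ : ∀ A, φ A = count (maskOf A)) {m v : ℕ} (h : maxCheck c count m v = true) :
    sSup (Set.range φ) = v := by
  simp only [maxCheck, Bool.and_eq_true, Nat.blt_eq, Nat.beq_eq, List.all_eq_true, List.mem_range,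
    Nat.ble_eq] at h
  refine IsGreatest.csSup_eq ⟨?_, ?_⟩
  · obtain ⟨A, hA⟩ := exists_maskOf_eq.{u} h.1
    exact ⟨A, by rw [hφ, hA, h.2.1]⟩
  · rintro _ ⟨A, rfl⟩
    exact (hφ A).trans_le (h.2.2 _ (maskOf_lt A))

/-- Test the conditions of a type by the codes of `ib`, `bi`, `b` and `bib`. -/
noncomputable def codeCheck (c : List ℕ) (n : ℕ) (s t r : Bool) : Bool :=
  Nat.beq (countDistinct ((kMaskOps c).map (opCode c))) n &&
  (Nat.beq (opCode c (wordMaskOp c (false, 4))) (opCode c (wordMaskOp c (false, 5))) == s &&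
  (Nat.beq (opCode c (wordMaskOp c (false, 3))) (opCode c (wordMaskOp c (false, 5))) == t &&
  Nat.beq (opCode c (wordMaskOp c (false, 1))) (opCode c (wordMaskOp c (false, 5))) == r))

/-- Test whether a finite space has a given type. -/
noncomputable def typeCheck (c : List ℕ) : SpaceType → Bool
  | .GE => Nat.beq (countDistinct ((kfMaskOps c).map (opCode c))) 34
  | .KD => Nat.beq (countDistinct ((kfMaskOps c).map (opCode c))) 28
  | .ED => codeCheck c 10 true false false
  | .OU => codeCheck c 10 false true false
  | .EO => codeCheck c 8 true true false
  | .partition => codeCheck c 6 true false true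
  | .discrete => codeCheck c 2 true true true

theorem codeCheck_spec (hc : validMasks c = true) (hne : c ≠ []) {n : ℕ} {s t r : Bool}
    (h : codeCheck c n s t r = true) :
    KNumber (FinSpace.{u} c) = n ∧
      (i (FinSpace.{u} c) ∘ b _ = b _ ∘ i _ ∘ b _ ↔ s = true) ∧
      (b (FinSpace.{u} c) ∘ i _ = b _ ∘ i _ ∘ b _ ↔ t = true) ∧
      (b (FinSpace.{u} c) = b _ ∘ i _ ∘ b _ ↔ r = true) := by
  have h1 := wordOp_eq_iff_opCode.{u} hc hne (false, 4) (false, 5)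
  have h2 := wordOp_eq_iff_opCode.{u} hc hne (false, 3) (false, 5)
  have h3 := wordOp_eq_iff_opCode.{u} hc hne (false, 1) (false, 5)
  simp only [codeCheck, Bool.and_eq_true, Nat.beq_eq, beq_iff_eq] at h
  rw [← Nat.beq_eq] at h1 h2 h3
  rw [h.2.1] at h1
  rw [h.2.2.1] at h2
  rw [h.2.2.2] at h3
  exact ⟨(KNumber_finSpace hc hne).trans h.1, h1, h2, h3⟩

theorem typeCheck_spec (hc : validMasks c = true) (hne : c ≠ []) {t : SpaceType}
    (h : typeCheck c t = true) : HasType (FinSpace.{u} c) t := by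
  cases t with
  | GE => exact (KfNumber_finSpace hc hne).trans (Nat.eq_of_beq_eq_true h)
  | KD => exact (KfNumber_finSpace hc hne).trans (Nat.eq_of_beq_eq_true h)
  | ED => simpa [HasType] using codeCheck_spec hc hne h
  | OU => simpa [HasType] using codeCheck_spec hc hne h
  | EO => simpa [HasType] using codeCheck_spec hc hne h
  | partition => simpa [HasType] using codeCheck_spec hc hne h
  | discrete => simpa [HasType] using codeCheck_spec hc hne h

/-- Test that the space given by the masks `c` has type `t`, that its `k`-number is `k`, attained
at the mask `m`, and that its `k_f`-number is `kf`, attained at the mask `mf`. -/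
noncomputable def spaceCheck (c : List ℕ) (t : SpaceType) (m k mf kf : ℕ) : Bool :=
  Nat.blt 0 c.length && (validMasks c && (typeCheck c t &&
    (maxCheck c (kCount c) m k && maxCheck c (kfCount c) mf kf)))

theorem mem_values_of_spaceCheck {c : List ℕ} {t : SpaceType} {m k mf kf : ℕ}
    (h : spaceCheck c t m k mf kf = true) : k ∈ kValues.{u} t ∧ kf ∈ kfValues.{u} t := by
  simp only [spaceCheck, Bool.and_eq_true, Nat.blt_eq] at h
  obtain ⟨hlen, hc, ht, hk, hkf⟩ := h
  have hne : c ≠ [] := List.length_pos_iff.1 hlen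
  have : Nonempty (FinSpace.{u} c) := ⟨⟨⟨0, hlen⟩⟩⟩
  have hT := typeCheck_spec.{u} hc hne ht
  exact ⟨⟨FinSpace.{u} c, inferInstance, this, hT, sSup_eq_of_maxCheck (kOf_eq_kCount hc) hk⟩,
    ⟨FinSpace.{u} c, inferInstance, this, hT, sSup_eq_of_maxCheck (kfOf_eq_kfCount hc) hkf⟩⟩

end FinSpace

/-! ### Examples of finite spaces -/

/-- In binary the masks say that the closures of 0 and 3 are both `{0, 2, 3}`, that of 1 is `{1,
2}`, and 2 is closed: an indiscrete pair and an open point share a limit. For `{0, 1}` the point 2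
lies in cell 8. -/
theorem mem_values_GE_8_10 : 8 ∈ kValues.{u} .GE ∧ 10 ∈ kfValues.{u} .GE :=
  mem_values_of_spaceCheck (c := [13, 6, 4, 13]) (m := 1) (mf := 1)
    (by decide +kernel)

theorem mem_values_GE_8_14 : 8 ∈ kValues.{u} .GE ∧ 14 ∈ kfValues.{u} .GE :=
  mem_values_of_spaceCheck (c := [29, 10, 4, 8, 29]) (m := 1) (mf := 6)
    (by decide +kernel)

theorem mem_values_GE_8_16 : 8 ∈ kValues.{u} .GE ∧ 16 ∈ kfValues.{u} .GE :=
  mem_values_of_spaceCheck (c := [25, 10, 4, 8, 25]) (m := 1) (mf := 3)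
    (by decide +kernel)

theorem mem_values_GE_10_18 : 10 ∈ kValues.{u} .GE ∧ 18 ∈ kfValues.{u} .GE :=
  mem_values_of_spaceCheck (c := [25, 10, 12, 8, 25]) (m := 3) (mf := 3)
    (by decide +kernel)

theorem mem_values_GE_10_20 : 10 ∈ kValues.{u} .GE ∧ 20 ∈ kfValues.{u} .GE :=
  mem_values_of_spaceCheck (c := [57, 26, 20, 8, 16, 57]) (m := 3) (mf := 3)
    (by decide +kernel)

theorem mem_values_GE_10_22 : 10 ∈ kValues.{u} .GE ∧ 22 ∈ kfValues.{u} .GE :=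
  mem_values_of_spaceCheck (c := [25, 50, 4, 8, 16, 50]) (m := 3) (mf := 3)
    (by decide +kernel)

theorem mem_values_GE_10_24 : 10 ∈ kValues.{u} .GE ∧ 24 ∈ kfValues.{u} .GE :=
  mem_values_of_spaceCheck (c := [9, 50, 20, 8, 16, 50]) (m := 3) (mf := 3)
    (by decide +kernel)

theorem mem_values_GE_10_26 : 10 ∈ kValues.{u} .GE ∧ 26 ∈ kfValues.{u} .GE :=
  mem_values_of_spaceCheck (c := [89, 42, 52, 8, 16, 32, 89]) (m := 3) (mf := 3)
    (by decide +kernel)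

theorem mem_values_GE_12_28 : 12 ∈ kValues.{u} .GE ∧ 28 ∈ kfValues.{u} .GE :=
  mem_values_of_spaceCheck (c := [41, 18, 100, 8, 16, 32, 100]) (m := 14) (mf := 14)
    (by decide +kernel)

theorem mem_values_GE_12_30 : 12 ∈ kValues.{u} .GE ∧ 30 ∈ kfValues.{u} .GE :=
  mem_values_of_spaceCheck (c := [25, 50, 100, 8, 16, 32, 100]) (m := 5) (mf := 5)
    (by decide +kernel)

theorem mem_values_GE_14_32 : 14 ∈ kValues.{u} .GE ∧ 32 ∈ kfValues.{u} .GE :=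
  mem_values_of_spaceCheck (c := [225, 70, 70, 216, 16, 32, 64, 128]) (m := 19) (mf := 19)
    (by decide +kernel)

theorem mem_values_GE_14_34 : 14 ∈ kValues.{u} .GE ∧ 34 ∈ kfValues.{u} .GE :=
  mem_values_of_spaceCheck (c := [177, 38, 38, 200, 16, 32, 64, 128]) (m := 26) (mf := 26)
    (by decide +kernel)

/-- A disjoint sum: two open points 0, 1 with common limit 3, where `{0}` produces region five, and
an indiscrete pair 2, 4, where `{2}` produces region four. -/
theorem mem_values_KD_10_18 : 10 ∈ kValues.{u} .KD ∧ 18 ∈ kfValues.{u} .KD :=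
  mem_values_of_spaceCheck (c := [9, 10, 20, 8, 20]) (m := 5) (mf := 5)
    (by decide +kernel)

theorem mem_values_KD_12_22 : 12 ∈ kValues.{u} .KD ∧ 22 ∈ kfValues.{u} .KD :=
  mem_values_of_spaceCheck (c := [25, 18, 36, 8, 16, 36]) (m := 5) (mf := 5)
    (by decide +kernel)

theorem mem_values_KD_14_28 : 14 ∈ kValues.{u} .KD ∧ 28 ∈ kfValues.{u} .KD :=
  mem_values_of_spaceCheck (c := [17, 2, 4, 8, 17, 38, 74]) (m := 41) (mf := 41)
    (by decide +kernel)

theorem mem_values_ED_4_4 : 4 ∈ kValues.{u} .ED ∧ 4 ∈ kfValues.{u} .ED :=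
  mem_values_of_spaceCheck (c := [7, 2, 7]) (m := 1) (mf := 1)
    (by decide +kernel)

theorem mem_values_ED_6_6 : 6 ∈ kValues.{u} .ED ∧ 6 ∈ kfValues.{u} .ED :=
  mem_values_of_spaceCheck (c := [15, 6, 4, 15]) (m := 2) (mf := 2)
    (by decide +kernel)

theorem mem_values_ED_6_8 : 6 ∈ kValues.{u} .ED ∧ 8 ∈ kfValues.{u} .ED :=
  mem_values_of_spaceCheck (c := [13, 2, 4, 13]) (m := 1) (mf := 6)
    (by decide +kernel)

theorem mem_values_ED_8_10 : 8 ∈ kValues.{u} .ED ∧ 10 ∈ kfValues.{u} .ED :=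
  mem_values_of_spaceCheck (c := [5, 10, 4, 10]) (m := 3) (mf := 3)
    (by decide +kernel)

theorem mem_values_ED_8_16 : 8 ∈ kValues.{u} .ED ∧ 16 ∈ kfValues.{u} .ED :=
  mem_values_of_spaceCheck (c := [9, 18, 4, 8, 18]) (m := 3) (mf := 3)
    (by decide +kernel)

theorem mem_values_ED_10_22 : 10 ∈ kValues.{u} .ED ∧ 22 ∈ kfValues.{u} .ED :=
  mem_values_of_spaceCheck (c := [9, 18, 36, 8, 16, 36]) (m := 14) (mf := 14)
    (by decide +kernel)

theorem mem_values_OU_4_8 : 4 ∈ kValues.{u} .OU ∧ 8 ∈ kfValues.{u} .OU :=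
  mem_values_of_spaceCheck (c := [5, 6, 4]) (m := 1) (mf := 1)
    (by decide +kernel)

theorem mem_values_OU_6_10 : 6 ∈ kValues.{u} .OU ∧ 10 ∈ kfValues.{u} .OU :=
  mem_values_of_spaceCheck (c := [13, 14, 4, 8]) (m := 5) (mf := 5)
    (by decide +kernel)

theorem mem_values_OU_8_14 : 8 ∈ kValues.{u} .OU ∧ 14 ∈ kfValues.{u} .OU :=
  mem_values_of_spaceCheck (c := [13, 10, 4, 8]) (m := 6) (mf := 6)
    (by decide +kernel)

theorem mem_values_OU_8_16 : 8 ∈ kValues.{u} .OU ∧ 16 ∈ kfValues.{u} .OU :=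
  mem_values_of_spaceCheck (c := [9, 18, 20, 8, 16]) (m := 10) (mf := 14)
    (by decide +kernel)

theorem mem_values_OU_10_20 : 10 ∈ kValues.{u} .OU ∧ 20 ∈ kfValues.{u} .OU :=
  mem_values_of_spaceCheck (c := [1, 2, 4, 11, 21]) (m := 12) (mf := 12)
    (by decide +kernel)

theorem mem_values_EO_4_4 : 4 ∈ kValues.{u} .EO ∧ 4 ∈ kfValues.{u} .EO :=
  mem_values_of_spaceCheck (c := [3, 2]) (m := 1) (mf := 1)
    (by decide +kernel)

theorem mem_values_EO_6_6 : 6 ∈ kValues.{u} .EO ∧ 6 ∈ kfValues.{u} .EO :=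
  mem_values_of_spaceCheck (c := [7, 6, 4]) (m := 2) (mf := 2)
    (by decide +kernel)

theorem mem_values_EO_4_8 : 4 ∈ kValues.{u} .EO ∧ 8 ∈ kfValues.{u} .EO :=
  mem_values_of_spaceCheck (c := [5, 2, 4]) (m := 1) (mf := 1)
    (by decide +kernel)

theorem mem_values_EO_6_10 : 6 ∈ kValues.{u} .EO ∧ 10 ∈ kfValues.{u} .EO :=
  mem_values_of_spaceCheck (c := [13, 2, 12, 8]) (m := 4) (mf := 6)
    (by decide +kernel)

theorem mem_values_EO_8_16 : 8 ∈ kValues.{u} .EO ∧ 16 ∈ kfValues.{u} .EO :=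
  mem_values_of_spaceCheck (c := [5, 10, 4, 8]) (m := 6) (mf := 6)
    (by decide +kernel)

theorem mem_values_partition_4_4 : 4 ∈ kValues.{u} .partition ∧ 4 ∈ kfValues.{u} .partition :=
  mem_values_of_spaceCheck (c := [3, 3]) (m := 1) (mf := 1)
    (by decide +kernel)

theorem mem_values_partition_6_6 : 6 ∈ kValues.{u} .partition ∧ 6 ∈ kfValues.{u} .partition :=
  mem_values_of_spaceCheck (c := [5, 2, 5]) (m := 1) (mf := 1)
    (by decide +kernel)

theorem mem_values_partition_6_10 : 6 ∈ kValues.{u} .partition ∧ 10 ∈ kfValues.{u} .partition :=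
  mem_values_of_spaceCheck (c := [9, 2, 4, 9]) (m := 1) (mf := 3)
    (by decide +kernel)

theorem mem_values_discrete_2_2 : 2 ∈ kValues.{u} .discrete ∧ 2 ∈ kfValues.{u} .discrete :=
  mem_values_of_spaceCheck (c := [1]) (m := 0) (mf := 0)
    (by decide +kernel)

theorem mem_values_discrete_2_4 : 2 ∈ kValues.{u} .discrete ∧ 4 ∈ kfValues.{u} .discrete :=
  mem_values_of_spaceCheck (c := [1, 2]) (m := 0) (mf := 1)
    (by decide +kernel)

section Spaces

variable {X : Type u} [TopologicalSpace X]

/-! ### The numbers of a space in terms of cells -/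

theorem exists_kBits_eq (X : Type u) [TopologicalSpace X] :
    ∃ A : Set X, kBits (bits (cells A)) = kNumber X := by
  obtain ⟨A, hA⟩ := (isGreatest_kNumber X).1
  exact ⟨A, by rw [← kOf_eq_kBits]; exact hA⟩

theorem exists_kfBits_eq (X : Type u) [TopologicalSpace X] :
    ∃ A : Set X, kfBits (bits (cells A)) = kfNumber X := by
  obtain ⟨A, hA⟩ := (isGreatest_kfNumber X).1
  exact ⟨A, by rw [← kfOf_eq_kfBits]; exact hA⟩

theorem kBits_le (A : Set X) : kBits (bits (cells A)) ≤ kNumber X := by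
  rw [← kOf_eq_kBits]
  exact (isGreatest_kNumber X).2 ⟨A, rfl⟩

theorem kfBits_le (A : Set X) : kfBits (bits (cells A)) ≤ kfNumber X := by
  rw [← kfOf_eq_kfBits]
  exact (isGreatest_kfNumber X).2 ⟨A, rfl⟩

theorem kfBits_mem {S : Set ℕ} (hS : IsPattern S) : kfBits (bits S) ∈
    ([2, 4, 6, 8, 10, 12, 14, 16, 18, 20, 22, 24, 26, 28, 30, 32, 34] : List ℕ) := by
  by_cases h : ∀ j ∈ ([2, 3, 4, 5, 6, 7, 8, 9, 10, 11, 12, 13, 14, 15] : List ℕ), j ∉ S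
  · have := kfBits_mem_of_discrete hS h
    simp only [List.mem_cons, List.not_mem_nil, or_false] at this ⊢
    omega
  · push Not at h
    have := kfBits_of_nondiscrete hS (by simpa using h)
    exact List.mem_cons_of_mem _ this

theorem kBits_mem {S : Set ℕ} (hS : IsPattern S) : kBits (bits S) ∈
    ([2, 4, 6, 8, 10, 12, 14] : List ℕ) := by
  by_cases h : ∀ j ∈ ([2, 3, 4, 5, 6, 7, 8, 9, 10, 11, 12, 13, 14, 15] : List ℕ), j ∉ S
  · have := kBits_mem_of_discrete hS h
    simp only [List.mem_cons, List.not_mem_nil, or_false] at this ⊢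
    omega
  · push Not at h
    have := kBits_of_nondiscrete hS (by simpa using h)
    exact List.mem_cons_of_mem _ this

theorem four_le_of_nondiscrete [Nonempty X] {A : Set X}
    (h : ∃ j ∈ ([2, 3, 4, 5, 6, 7, 8, 9, 10, 11, 12, 13, 14, 15] : List ℕ), j ∈ cells A) :
    4 ≤ kNumber X ∧ 4 ≤ kfNumber X := by
  have h1 := kBits_of_nondiscrete (isPattern_cells A) (by simpa using h)
  have h2 := kfBits_of_nondiscrete (isPattern_cells A) (by simpa using h)
  have h1' := kBits_le A
  have h2' := kfBits_le A
  simp only [List.mem_cons, List.not_mem_nil, or_false] at h1 h2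
  omega

theorem kfNumber_ne_twelve [Nonempty X] : kfNumber X ≠ 12 := by
  intro h12
  have key : ∀ A : Set X, 11 ∈ cells A → 5 ∈ cells A → False := fun A h11 h5 => by
    obtain ⟨B, h10, h5'⟩ := exists_five_eight h11 h5
    have h1 := kfBits_of_five_eight (isPattern_cells B) h10 h5'
    have h2 := kfBits_le B
    simp only [List.mem_cons, List.not_mem_nil, or_false] at h1
    omega
  obtain ⟨A, hA⟩ := exists_kfBits_eq X
  have hP := isPattern_cells A
  have h1 : ¬ (2 ∉ cells A ∧ 5 ∉ cells A) := fun h => by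
    have := kfBits_ne_of_not_two_eight hP (by simpa using h)
    simp [hA, h12] at this
  have h2 : ¬ (5 ∉ cells A ∧ 10 ∉ cells A) := fun h => by
    have := kfBits_ne_of_not_five_eight hP (by simpa using h)
    simp [hA, h12] at this
  have h3 : ¬ (2 ∉ cells A ∧ 11 ∉ cells A) := fun h => by
    have := kfBits_ne_of_not_two_five hP (by simpa using h)
    simp [hA, h12] at this
  have h4 : ¬ (10 ∉ cells A ∧ 11 ∉ cells A) := fun h => by
    have := kfBits_ne_of_not_five hP (by simpa using h)
    simp [hA, h12] at this
  -- The two alternatives are exchanged by complementation, so one improvement step settles both.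
  have h5 : (11 ∈ cells A ∧ 5 ∈ cells A) ∨ (10 ∈ cells A ∧ 2 ∈ cells A) := by tauto
  rcases h5 with h | h
  · exact key A h.1 h.2
  · exact key Aᶜ (dualCell_mem_cells_compl h.1) (dualCell_mem_cells_compl h.2)

/-! ### Kuratowski spaces -/

theorem notMem_cells_of_not_three (h3 : ∀ A : Set X, 8 ∉ cells A ∧ 9 ∉ cells A) (A : Set X) :
    ∀ j ∈ ([8, 9, 12, 13, 14, 15] : List ℕ), j ∉ cells A := by
  have h6 : ¬ (12 ∈ cells A ∨ 13 ∈ cells A) := fun h => by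
    obtain ⟨B, hB⟩ := exists_three_of_six h
    exact hB.elim (h3 B).1 (h3 B).2
  have h7 : ¬ (14 ∈ cells A ∨ 15 ∈ cells A) := fun h => by
    obtain ⟨B, hB⟩ := exists_three_of_seven h
    exact hB.elim (h3 B).1 (h3 B).2
  have := h3 A
  simp only [List.mem_cons, List.not_mem_nil, or_false, forall_eq_or_imp, forall_eq]
  tauto

theorem notMem_allCells {l : List ℕ} (h : ∀ A : Set X, ∀ j ∈ l, j ∉ cells A) :
    ∀ j ∈ l, j ∉ allCells X := fun j hj hjX => by
  obtain ⟨A, hA⟩ := Set.mem_iUnion.1 hjX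
  exact h A j hj hA

/-- Without region three for any subset, regions six and seven are absent too, and the operator
count is at most 28. -/
theorem exists_three_of_GE [Nonempty X] (h : KfNumber X = 34) :
    ∃ A : Set X, 8 ∈ cells A ∨ 9 ∈ cells A := by
  by_contra hne
  push Not at hne
  have := kfBits_mem_of_not_three (isPattern_allCells X)
    (notMem_allCells (notMem_cells_of_not_three hne))
  rw [← KfNumber_eq_kfBits, h] at this
  simp at this

/-- The complement of a set with region three has region seven. Both then occur in `allCells X`,
where they are incompatible with the count 28. -/
theorem not_three_of_KD [Nonempty X] (h : KfNumber X = 28) (A : Set X) :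
    8 ∉ cells A ∧ 9 ∉ cells A := by
  by_contra hne
  have h3 : 8 ∈ cells A ∨ 9 ∈ cells A := by tauto
  obtain ⟨B, h7⟩ := exists_seven_of_three h3
  have := kfBits_of_three_seven (isPattern_allCells X)
    (h3.imp (fun h => cells_subset_allCells h) fun h => cells_subset_allCells h)
    (h7.imp (fun h => cells_subset_allCells h) fun h => cells_subset_allCells h)
  rw [← KfNumber_eq_kfBits, h] at this
  simp at this

theorem exists_five_of_allCells (h : 10 ∈ allCells X ∨ 11 ∈ allCells X) :
    ∃ A : Set X, 10 ∈ cells A ∨ 11 ∈ cells A := by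
  rcases h with h | h <;> obtain ⟨A, hA⟩ := Set.mem_iUnion.1 h
  exacts [⟨A, Or.inl hA⟩, ⟨A, Or.inr hA⟩]

theorem four_five_of_KD [Nonempty X] (h : KfNumber X = 28) :
    6 ∈ allCells X ∧ ∃ A : Set X, 10 ∈ cells A ∨ 11 ∈ cells A := by
  have h3 := notMem_allCells (notMem_cells_of_not_three (not_three_of_KD h))
  have hP := isPattern_allCells X
  constructor
  · by_contra h6
    have h7 := mt hP.four.2 h6
    have := kfBits_mem_of_not_four hP (by
      simp only [List.mem_cons, List.not_mem_nil, or_false, forall_eq_or_imp, forall_eq] at h3 ⊢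
      tauto)
    rw [← KfNumber_eq_kfBits, h] at this
    simp at this
  · by_contra h5
    have h5' := mt exists_five_of_allCells h5
    have := kfBits_mem_of_not_five hP (by
      simp only [List.mem_cons, List.not_mem_nil, or_false, forall_eq_or_imp, forall_eq] at h3 ⊢
      tauto)
    rw [← KfNumber_eq_kfBits, h] at this
    simp at this

theorem kfNumber_mem_of_KD [Nonempty X] (h : KfNumber X = 28) :
    kfNumber X = 18 ∨ kfNumber X = 22 ∨ kfNumber X = 28 := by
  have h3 := not_three_of_KD h
  have habs := notMem_cells_of_not_three h3
  obtain ⟨h6, A₀, h5⟩ := four_five_of_KD h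
  obtain ⟨B, hB4, hB5⟩ := exists_four_five h3 h6 h5
  have hB := kfBits_of_four_five (isPattern_cells B) (habs B) (Or.inl hB4) hB5
  have hB' := kfBits_le B
  obtain ⟨A, hA⟩ := exists_kfBits_eq X
  have hP := isPattern_cells A
  have hmem := kfBits_mem_of_not_three hP (habs A)
  -- A subset attaining 20 has region five and cells 2 and 5. Creating region four while keeping
  -- region five and one of these cells gives at least 22.
  have h20 : kfNumber X ≠ 20 := by
    intro h20
    have ha := habs A
    simp only [List.mem_cons, List.not_mem_nil, or_false, forall_eq_or_imp, forall_eq] at ha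
    have hA5 : 10 ∈ cells A ∨ 11 ∈ cells A := by
      by_contra hne
      have := kfBits_mem_of_not_five hP (by
        simp only [List.mem_cons, List.not_mem_nil, or_false, forall_eq_or_imp, forall_eq]
        tauto)
      simp [hA, h20] at this
    have hA2 : 2 ∈ cells A := by
      by_contra hne
      have := kfBits_mem_of_not_two hP (by
        simp only [List.mem_cons, List.not_mem_nil, or_false, forall_eq_or_imp, forall_eq]
        tauto)
      simp [hA, h20] at this
    have hA8 : 5 ∈ cells A := by
      by_contra hne
      have := kfBits_mem_of_not_eight hP (by
        simp only [List.mem_cons, List.not_mem_nil, or_false, forall_eq_or_imp, forall_eq]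
        tauto)
      simp [hA, h20] at this
    obtain ⟨C, hC4, hC5, hC⟩ := exists_four_five_two_or_eight h3 h6 hA5 hA2 hA8
    have hC' := kfBits_le C
    have : kfBits (bits (cells C)) ∈ ([22, 28] : List ℕ) := by
      rcases hC with hC | hC
      · exact kfBits_of_four_five_two (isPattern_cells C) (habs C) (Or.inl hC4) hC5 hC
      · exact kfBits_of_four_five_eight (isPattern_cells C) (habs C) (Or.inl hC4) hC5 hC
    simp only [List.mem_cons, List.not_mem_nil, or_false] at this
    omega
  simp only [List.mem_cons, List.not_mem_nil, or_false, hA] at hB hmem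
  omega

theorem ten_le_kNumber_of_not_three [Nonempty X] (h3 : ∀ A : Set X, 8 ∉ cells A ∧ 9 ∉ cells A)
    (h6 : 6 ∈ allCells X) {A : Set X} (h5 : 10 ∈ cells A ∨ 11 ∈ cells A) : 10 ≤ kNumber X := by
  obtain ⟨B, hB4, hB5⟩ := exists_four_five h3 h6 h5
  have hB := kBits_of_four_five (isPattern_cells B) (notMem_cells_of_not_three h3 B)
    (Or.inl hB4) hB5
  have hB' := kBits_le B
  simp only [List.mem_cons, List.not_mem_nil, or_false] at hB
  omega

theorem eight_le_kNumber_of_three [Nonempty X] {A : Set X} (h : 8 ∈ cells A ∨ 9 ∈ cells A) :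
    8 ≤ kNumber X := by
  have hA := kBits_of_three (isPattern_cells A) h
  have hA' := kBits_le A
  simp only [List.mem_cons, List.not_mem_nil, or_false] at hA
  omega

/-- Either region three occurs, which by itself forces 8, or `K(X) = 14` requires regions four and
five, and a single subset having both gives 10. -/
theorem eight_le_kNumber_of_isKuratowski [Nonempty X] (h : IsKuratowski X) : 8 ≤ kNumber X := by
  by_cases h3 : ∀ A : Set X, 8 ∉ cells A ∧ 9 ∉ cells A
  · have habs := notMem_allCells (notMem_cells_of_not_three h3)
    simp only [List.mem_cons, List.not_mem_nil, or_false, forall_eq_or_imp, forall_eq] at habs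
    have hP := isPattern_allCells X
    rw [IsKuratowski, KNumber_eq_kBits] at h
    have h6 : 6 ∈ allCells X := by
      by_contra h6
      have h7 := mt hP.four.2 h6
      have := kBits_mem_of_not_four hP (by simpa using ⟨h6, h7⟩)
      simp [h] at this
    have h5 : 10 ∈ allCells X ∨ 11 ∈ allCells X := by
      by_contra h5
      have := kBits_mem_of_not_five_six_seven hP (by
        simp only [List.mem_cons, List.not_mem_nil, or_false, forall_eq_or_imp, forall_eq]
        tauto)
      simp [h] at this
    obtain ⟨A, hA⟩ := exists_five_of_allCells h5
    exact (by norm_num : 8 ≤ 10).trans (ten_le_kNumber_of_not_three h3 h6 hA)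
  · push Not at h3
    obtain ⟨A, hA⟩ := h3
    exact eight_le_kNumber_of_three (A := A) (by tauto)

theorem kNumber_mem [Nonempty X] : kNumber X ∈ ([2, 4, 6, 8, 10, 12, 14] : List ℕ) := by
  obtain ⟨A, hA⟩ := exists_kBits_eq X
  exact hA ▸ kBits_mem (isPattern_cells A)

theorem kfNumber_mem [Nonempty X] : kfNumber X ∈
    ([2, 4, 6, 8, 10, 12, 14, 16, 18, 20, 22, 24, 26, 28, 30, 32, 34] : List ℕ) := by
  obtain ⟨A, hA⟩ := exists_kfBits_eq X
  exact hA ▸ kfBits_mem (isPattern_cells A)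

/-! ### Coincidences of operators and empty cells -/

/-- Regions five, six and seven lie in `bib A \ ib A`. Region three is not in that difference, but
it is the dual of region seven. -/
theorem notMem_of_ib_eq (h : i X ∘ b X = b X ∘ i X ∘ b X) (A : Set X) :
    ∀ j ∈ ([8, 9, 10, 11, 12, 13, 14, 15] : List ℕ), j ∉ cells A := by
  have key : ∀ A : Set X, ∀ j ∈ ([10, 11, 12, 13, 14, 15] : List ℕ), j ∉ cells A := by
    rintro A j hj ⟨x, hx⟩
    have hA : interior (closure A) = closure (interior (closure A)) := congrFun h A
    have := cell_spec A x
    rw [← hA] at this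
    simp only [List.mem_cons, List.not_mem_nil, or_false] at hj
    rcases hj with rfl | rfl | rfl | rfl | rfl | rfl <;> simp [hx] at this <;> tauto
  have h1 := key A
  have h2 : 8 ∉ cells A := fun h => key Aᶜ 15 (by simp) (dualCell_mem_cells_compl h)
  have h3 : 9 ∉ cells A := fun h => key Aᶜ 14 (by simp) (dualCell_mem_cells_compl h)
  simp only [List.mem_cons, List.not_mem_nil, or_false, forall_eq_or_imp, forall_eq] at h1 ⊢
  tauto

/-- Regions four and seven make up `bib A \ bi A`; three is dual to seven, and six cannot occur
without four. -/
theorem notMem_of_bi_eq [Nonempty X] (h : b X ∘ i X = b X ∘ i X ∘ b X) (A : Set X) :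
    ∀ j ∈ ([6, 7, 8, 9, 12, 13, 14, 15] : List ℕ), j ∉ cells A := by
  have key : ∀ A : Set X, ∀ j ∈ ([6, 7, 14, 15] : List ℕ), j ∉ cells A := by
    rintro A j hj ⟨x, hx⟩
    have hA : closure (interior A) = closure (interior (closure A)) := congrFun h A
    have := cell_spec A x
    rw [← hA] at this
    simp only [List.mem_cons, List.not_mem_nil, or_false] at hj
    rcases hj with rfl | rfl | rfl | rfl <;> simp [hx] at this <;> tauto
  have h1 := key A
  have h6 := (isPattern_cells A).six
  have h2 : 8 ∉ cells A := fun h => key Aᶜ 15 (by simp) (dualCell_mem_cells_compl h)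
  have h3 : 9 ∉ cells A := fun h => key Aᶜ 14 (by simp) (dualCell_mem_cells_compl h)
  simp only [List.mem_cons, List.not_mem_nil, or_false, forall_eq_or_imp, forall_eq] at h1 ⊢
  tauto

theorem notMem_of_b_eq (h : b X = b X ∘ i X ∘ b X) (A : Set X) :
    ∀ j ∈ ([2, 3, 4, 5] : List ℕ), j ∉ cells A := by
  have key : ∀ A : Set X, ∀ j ∈ ([4, 5] : List ℕ), j ∉ cells A := by
    rintro A j hj ⟨x, hx⟩
    have hA : closure A = closure (interior (closure A)) := congrFun h A
    have := cell_spec A x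
    rw [← hA] at this
    simp only [List.mem_cons, List.not_mem_nil, or_false] at hj
    rcases hj with rfl | rfl <;> simp [hx] at this <;> tauto
  have h1 := key A
  have h2 : 2 ∉ cells A := fun h => key Aᶜ 5 (by simp) (dualCell_mem_cells_compl h)
  have h3 : 3 ∉ cells A := fun h => key Aᶜ 4 (by simp) (dualCell_mem_cells_compl h)
  simp only [List.mem_cons, List.not_mem_nil, or_false, forall_eq_or_imp, forall_eq] at h1 ⊢
  tauto

theorem exists_of_ib_ne (h : i X ∘ b X ≠ b X ∘ i X ∘ b X) :
    ∃ A : Set X, ∃ j ∈ ([10, 11, 12, 13, 14, 15] : List ℕ), j ∈ cells A := by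
  obtain ⟨A, hA⟩ := Function.ne_iff.1 h
  obtain ⟨x, hx, hx'⟩ := Set.not_subset.1 fun hs => hA ((ib_subset_bib A).antisymm hs)
  replace hx' : x ∉ interior (closure A) := hx'
  replace hx : x ∈ closure (interior (closure A)) := hx
  refine ⟨A, cell A x, ?_, x, rfl⟩
  have := cell_spec A x
  simp only [hx, hx', not_true_eq_false, false_and, and_false, false_or] at this
  rcases this with h | h | h | h | h | h <;> simp [h.1]

theorem nondiscrete_of_b_ne (h : b X ≠ b X ∘ i X ∘ b X) : ∃ A : Set X,
    ∃ j ∈ ([2, 3, 4, 5, 6, 7, 8, 9, 10, 11, 12, 13, 14, 15] : List ℕ), j ∈ cells A := by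
  obtain ⟨A, hA⟩ := Function.ne_iff.1 h
  obtain ⟨x, hx, hx'⟩ := Set.not_subset.1 fun hs => hA (Set.Subset.antisymm hs (bib_subset_b A))
  replace hx' : x ∉ closure (interior (closure A)) := hx'
  replace hx : x ∈ closure A := hx
  refine ⟨A, cell A x, ?_, x, rfl⟩
  have := cell_spec A x
  simp only [hx, hx', not_true_eq_false, false_and, and_false, or_false, false_or] at this
  rcases this with h | h <;> simp [h.1]

theorem nondiscrete_of_bi_ne (h : b X ∘ i X ≠ b X ∘ i X ∘ b X) : ∃ A : Set X,
    ∃ j ∈ ([2, 3, 4, 5, 6, 7, 8, 9, 10, 11, 12, 13, 14, 15] : List ℕ), j ∈ cells A := by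
  obtain ⟨A, hA⟩ := Function.ne_iff.1 h
  obtain ⟨x, hx, hx'⟩ := Set.not_subset.1 fun hs => hA ((bi_subset_bib A).antisymm hs)
  replace hx' : x ∉ closure (interior A) := hx'
  replace hx : x ∈ closure (interior (closure A)) := hx
  refine ⟨A, cell A x, ?_, x, rfl⟩
  have := cell_spec A x
  simp only [hx, hx', not_true_eq_false, false_and, and_false, false_or] at this
  rcases this with h | h | h | h <;> simp [h.1]

/-! ### The values for each type -/

theorem values_GE [Nonempty X] (h : HasType X .GE) :
    kNumber X ∈ ([8, 10, 12, 14] : List ℕ) ∧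
      kfNumber X ∈ ([10, 14, 16, 18, 20, 22, 24, 26, 28, 30, 32, 34] : List ℕ) := by
  obtain ⟨A, hA⟩ := exists_three_of_GE h
  have h1 := kfBits_of_three (isPattern_cells A) hA
  have h1' := kfBits_le A
  have h2 := eight_le_kNumber_of_three hA
  have h3 := kNumber_mem (X := X)
  have h4 := kfNumber_mem (X := X)
  have h5 := kfNumber_ne_twelve (X := X)
  simp only [List.mem_cons, List.not_mem_nil, or_false] at *
  omega

theorem values_KD [Nonempty X] (h : HasType X .KD) :
    kNumber X ∈ ([10, 12, 14] : List ℕ) ∧ kfNumber X ∈ ([18, 22, 28] : List ℕ) := by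
  obtain ⟨h6, A, h5⟩ := four_five_of_KD h
  have h1 := kfNumber_mem_of_KD h
  have h2 := ten_le_kNumber_of_not_three (not_three_of_KD h) h6 h5
  have h3 := kNumber_mem (X := X)
  simp only [List.mem_cons, List.not_mem_nil, or_false] at *
  omega

theorem values_ED [Nonempty X] (h : HasType X .ED) :
    kNumber X ∈ ([4, 6, 8, 10] : List ℕ) ∧ kfNumber X ∈ ([4, 6, 8, 10, 16, 22] : List ℕ) := by
  obtain ⟨-, hib, -, hb⟩ := h
  obtain ⟨C, hC⟩ := nondiscrete_of_b_ne hb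
  have h4 := four_le_of_nondiscrete hC
  obtain ⟨A, hA⟩ := exists_kBits_eq X
  obtain ⟨B, hB⟩ := exists_kfBits_eq X
  have h1 := kBits_mem_of_ED (isPattern_cells A) (notMem_of_ib_eq hib A)
  have h2 := kfBits_mem_of_ED (isPattern_cells B) (notMem_of_ib_eq hib B)
  simp only [List.mem_cons, List.not_mem_nil, or_false] at *
  omega

theorem values_OU [Nonempty X] (h : HasType X .OU) :
    kNumber X ∈ ([4, 6, 8, 10] : List ℕ) ∧ kfNumber X ∈ ([8, 10, 14, 16, 20] : List ℕ) := by
  obtain ⟨-, hib, hbi, hb⟩ := h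
  obtain ⟨C, hC⟩ := nondiscrete_of_b_ne hb
  have h4 := (four_le_of_nondiscrete hC).1
  -- Of the regions that witness `ib ≠ bib` only five is compatible with `bi = bib`; its presence
  -- forces `k_f ≥ 8`.
  obtain ⟨D, j, hj, hD⟩ := exists_of_ib_ne hib
  have habs := notMem_of_bi_eq hbi
  have h5 : 10 ∈ cells D ∨ 11 ∈ cells D := by
    have := habs D
    simp only [List.mem_cons, List.not_mem_nil, or_false, forall_eq_or_imp, forall_eq] at hj this
    rcases hj with rfl | rfl | rfl | rfl | rfl | rfl <;> tauto
  have h8 := kfBits_of_OU (isPattern_cells D) (habs D) h5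
  have h8' := kfBits_le D
  obtain ⟨A, hA⟩ := exists_kBits_eq X
  obtain ⟨B, hB⟩ := exists_kfBits_eq X
  have h1 := kBits_mem_of_OU (isPattern_cells A) (habs A)
  have h2 := kfBits_mem_of_OU (isPattern_cells B) (habs B)
  have h12 := kfNumber_ne_twelve (X := X)
  simp only [List.mem_cons, List.not_mem_nil, or_false] at h1 h2 h8 ⊢
  omega

theorem values_EO [Nonempty X] (h : HasType X .EO) :
    kNumber X ∈ ([4, 6, 8] : List ℕ) ∧ kfNumber X ∈ ([4, 6, 8, 10, 16] : List ℕ) := by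
  obtain ⟨-, hib, hbi, hb⟩ := h
  obtain ⟨C, hC⟩ := nondiscrete_of_b_ne hb
  have h4 := four_le_of_nondiscrete hC
  have habs : ∀ A : Set X, ∀ j ∈ ([6, 7, 8, 9, 10, 11, 12, 13, 14, 15] : List ℕ), j ∉ cells A := by
    intro A
    have h1 := notMem_of_ib_eq hib A
    have h2 := notMem_of_bi_eq hbi A
    simp only [List.mem_cons, List.not_mem_nil, or_false, forall_eq_or_imp, forall_eq] at h1 h2 ⊢
    tauto
  obtain ⟨A, hA⟩ := exists_kBits_eq X
  obtain ⟨B, hB⟩ := exists_kfBits_eq X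
  have h1 := kBits_mem_of_EO (isPattern_cells A) (habs A)
  have h2 := kfBits_mem_of_EO (isPattern_cells B) (habs B)
  simp only [List.mem_cons, List.not_mem_nil, or_false] at h1 h2 ⊢
  omega

theorem values_partition [Nonempty X] (h : HasType X .partition) :
    kNumber X ∈ ([4, 6] : List ℕ) ∧ kfNumber X ∈ ([4, 6, 10] : List ℕ) := by
  obtain ⟨-, hib, hbi, hb⟩ := h
  obtain ⟨C, hC⟩ := nondiscrete_of_bi_ne hbi
  have h4 := four_le_of_nondiscrete hC
  have habs : ∀ A : Set X,
      ∀ j ∈ ([2, 3, 4, 5, 8, 9, 10, 11, 12, 13, 14, 15] : List ℕ), j ∉ cells A := by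
    intro A
    have h1 := notMem_of_ib_eq hib A
    have h2 := notMem_of_b_eq hb A
    simp only [List.mem_cons, List.not_mem_nil, or_false, forall_eq_or_imp, forall_eq] at h1 h2 ⊢
    tauto
  obtain ⟨A, hA⟩ := exists_kBits_eq X
  obtain ⟨B, hB⟩ := exists_kfBits_eq X
  have h1 := kBits_mem_of_partition (isPattern_cells A) (habs A)
  have h2 := kfBits_mem_of_partition (isPattern_cells B) (habs B)
  simp only [List.mem_cons, List.not_mem_nil, or_false] at h1 h2 ⊢
  omega

theorem values_discrete [Nonempty X] (h : HasType X .discrete) :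
    kNumber X ∈ ([2] : List ℕ) ∧ kfNumber X ∈ ([2, 4] : List ℕ) := by
  obtain ⟨-, hib, hbi, hb⟩ := h
  have habs : ∀ A : Set X,
      ∀ j ∈ ([2, 3, 4, 5, 6, 7, 8, 9, 10, 11, 12, 13, 14, 15] : List ℕ), j ∉ cells A := by
    intro A
    have h1 := notMem_of_ib_eq hib A
    have h2 := notMem_of_b_eq hb A
    have h3 := notMem_of_bi_eq hbi A
    simp only [List.mem_cons, List.not_mem_nil, or_false, forall_eq_or_imp, forall_eq] at h1 h2 h3 ⊢
    tauto
  obtain ⟨A, hA⟩ := exists_kBits_eq X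
  obtain ⟨B, hB⟩ := exists_kfBits_eq X
  have h1 := kBits_mem_of_discrete (isPattern_cells A) (habs A)
  have h2 := kfBits_mem_of_discrete (isPattern_cells B) (habs B)
  exact ⟨hA ▸ h1, hB ▸ h2⟩

end Spaces

/-! ### The table: bounds combined with examples -/

theorem kValues_GE : kValues.{u} .GE = {8, 10, 12, 14} := by
  ext n
  constructor
  · rintro ⟨X, _, _, hX, rfl⟩
    simpa using (values_GE hX).1
  · simp only [Set.mem_insert_iff, Set.mem_singleton_iff]
    rintro (rfl | rfl | rfl | rfl)
    · exact mem_values_GE_8_10.1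
    · exact mem_values_GE_10_18.1
    · exact mem_values_GE_12_28.1
    · exact mem_values_GE_14_32.1

theorem kValues_KD : kValues.{u} .KD = {10, 12, 14} := by
  ext n
  constructor
  · rintro ⟨X, _, _, hX, rfl⟩
    simpa using (values_KD hX).1
  · simp only [Set.mem_insert_iff, Set.mem_singleton_iff]
    rintro (rfl | rfl | rfl)
    · exact mem_values_KD_10_18.1
    · exact mem_values_KD_12_22.1
    · exact mem_values_KD_14_28.1

theorem kValues_ED : kValues.{u} .ED = {4, 6, 8, 10} := by
  ext n
  constructor
  · rintro ⟨X, _, _, hX, rfl⟩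
    simpa using (values_ED hX).1
  · simp only [Set.mem_insert_iff, Set.mem_singleton_iff]
    rintro (rfl | rfl | rfl | rfl)
    · exact mem_values_ED_4_4.1
    · exact mem_values_ED_6_6.1
    · exact mem_values_ED_8_10.1
    · exact mem_values_ED_10_22.1

theorem kValues_OU : kValues.{u} .OU = {4, 6, 8, 10} := by
  ext n
  constructor
  · rintro ⟨X, _, _, hX, rfl⟩
    simpa using (values_OU hX).1
  · simp only [Set.mem_insert_iff, Set.mem_singleton_iff]
    rintro (rfl | rfl | rfl | rfl)
    · exact mem_values_OU_4_8.1
    · exact mem_values_OU_6_10.1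
    · exact mem_values_OU_8_14.1
    · exact mem_values_OU_10_20.1

theorem kValues_EO : kValues.{u} .EO = {4, 6, 8} := by
  ext n
  constructor
  · rintro ⟨X, _, _, hX, rfl⟩
    simpa using (values_EO hX).1
  · simp only [Set.mem_insert_iff, Set.mem_singleton_iff]
    rintro (rfl | rfl | rfl)
    · exact mem_values_EO_4_4.1
    · exact mem_values_EO_6_6.1
    · exact mem_values_EO_8_16.1

theorem kValues_partition : kValues.{u} .partition = {4, 6} := by
  ext n
  constructor
  · rintro ⟨X, _, _, hX, rfl⟩
    simpa using (values_partition hX).1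
  · simp only [Set.mem_insert_iff, Set.mem_singleton_iff]
    rintro (rfl | rfl)
    · exact mem_values_partition_4_4.1
    · exact mem_values_partition_6_6.1

theorem kValues_discrete : kValues.{u} .discrete = {2} := by
  ext n
  constructor
  · rintro ⟨X, _, _, hX, rfl⟩
    simpa using (values_discrete hX).1
  · simp only [Set.mem_singleton_iff]
    rintro (rfl)
    · exact mem_values_discrete_2_2.1

theorem kfValues_GE : kfValues.{u} .GE = {10, 14, 16, 18, 20, 22, 24, 26, 28, 30, 32, 34} := by
  ext n
  constructor
  · rintro ⟨X, _, _, hX, rfl⟩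
    simpa using (values_GE hX).2
  · simp only [Set.mem_insert_iff, Set.mem_singleton_iff]
    rintro (rfl | rfl | rfl | rfl | rfl | rfl | rfl | rfl | rfl | rfl | rfl | rfl)
    · exact mem_values_GE_8_10.2
    · exact mem_values_GE_8_14.2
    · exact mem_values_GE_8_16.2
    · exact mem_values_GE_10_18.2
    · exact mem_values_GE_10_20.2
    · exact mem_values_GE_10_22.2
    · exact mem_values_GE_10_24.2
    · exact mem_values_GE_10_26.2
    · exact mem_values_GE_12_28.2
    · exact mem_values_GE_12_30.2
    · exact mem_values_GE_14_32.2
    · exact mem_values_GE_14_34.2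

theorem kfValues_KD : kfValues.{u} .KD = {18, 22, 28} := by
  ext n
  constructor
  · rintro ⟨X, _, _, hX, rfl⟩
    simpa using (values_KD hX).2
  · simp only [Set.mem_insert_iff, Set.mem_singleton_iff]
    rintro (rfl | rfl | rfl)
    · exact mem_values_KD_10_18.2
    · exact mem_values_KD_12_22.2
    · exact mem_values_KD_14_28.2

theorem kfValues_ED : kfValues.{u} .ED = {4, 6, 8, 10, 16, 22} := by
  ext n
  constructor
  · rintro ⟨X, _, _, hX, rfl⟩
    simpa using (values_ED hX).2
  · simp only [Set.mem_insert_iff, Set.mem_singleton_iff]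
    rintro (rfl | rfl | rfl | rfl | rfl | rfl)
    · exact mem_values_ED_4_4.2
    · exact mem_values_ED_6_6.2
    · exact mem_values_ED_6_8.2
    · exact mem_values_ED_8_10.2
    · exact mem_values_ED_8_16.2
    · exact mem_values_ED_10_22.2

theorem kfValues_OU : kfValues.{u} .OU = {8, 10, 14, 16, 20} := by
  ext n
  constructor
  · rintro ⟨X, _, _, hX, rfl⟩
    simpa using (values_OU hX).2
  · simp only [Set.mem_insert_iff, Set.mem_singleton_iff]
    rintro (rfl | rfl | rfl | rfl | rfl)
    · exact mem_values_OU_4_8.2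
    · exact mem_values_OU_6_10.2
    · exact mem_values_OU_8_14.2
    · exact mem_values_OU_8_16.2
    · exact mem_values_OU_10_20.2

theorem kfValues_EO : kfValues.{u} .EO = {4, 6, 8, 10, 16} := by
  ext n
  constructor
  · rintro ⟨X, _, _, hX, rfl⟩
    simpa using (values_EO hX).2
  · simp only [Set.mem_insert_iff, Set.mem_singleton_iff]
    rintro (rfl | rfl | rfl | rfl | rfl)
    · exact mem_values_EO_4_4.2
    · exact mem_values_EO_6_6.2
    · exact mem_values_EO_4_8.2
    · exact mem_values_EO_6_10.2
    · exact mem_values_EO_8_16.2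

theorem kfValues_partition : kfValues.{u} .partition = {4, 6, 10} := by
  ext n
  constructor
  · rintro ⟨X, _, _, hX, rfl⟩
    simpa using (values_partition hX).2
  · simp only [Set.mem_insert_iff, Set.mem_singleton_iff]
    rintro (rfl | rfl | rfl)
    · exact mem_values_partition_4_4.2
    · exact mem_values_partition_6_6.2
    · exact mem_values_partition_6_10.2

theorem kfValues_discrete : kfValues.{u} .discrete = {2, 4} := by
  ext n
  constructor
  · rintro ⟨X, _, _, hX, rfl⟩
    simpa using (values_discrete hX).2
  · simp only [Set.mem_insert_iff, Set.mem_singleton_iff]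
    rintro (rfl | rfl)
    · exact mem_values_discrete_2_2.2
    · exact mem_values_discrete_2_4.2

end BoundaryMonoid

theorem mainTheorem10 :
    -- the `k`-numbers that occur for each type
    (BoundaryMonoid.kValues.{u} .GE = {8, 10, 12, 14} ∧
      BoundaryMonoid.kValues.{u} .KD = {10, 12, 14} ∧
      BoundaryMonoid.kValues.{u} .ED = {4, 6, 8, 10} ∧
      BoundaryMonoid.kValues.{u} .OU = {4, 6, 8, 10} ∧
      BoundaryMonoid.kValues.{u} .EO = {4, 6, 8} ∧
      BoundaryMonoid.kValues.{u} .partition = {4, 6} ∧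
      BoundaryMonoid.kValues.{u} .discrete = {2}) ∧
    -- the `k_f`-numbers that occur for each type
    (BoundaryMonoid.kfValues.{u} .GE = {10, 14, 16, 18, 20, 22, 24, 26, 28, 30, 32, 34} ∧
      BoundaryMonoid.kfValues.{u} .KD = {18, 22, 28} ∧
      BoundaryMonoid.kfValues.{u} .ED = {4, 6, 8, 10, 16, 22} ∧
      BoundaryMonoid.kfValues.{u} .OU = {8, 10, 14, 16, 20} ∧
      BoundaryMonoid.kfValues.{u} .EO = {4, 6, 8, 10, 16} ∧
      BoundaryMonoid.kfValues.{u} .partition = {4, 6, 10} ∧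
      BoundaryMonoid.kfValues.{u} .discrete = {2, 4}) ∧
    -- no Kuratowski space has `k`-number 6
    (∀ (X : Type u) [TopologicalSpace X] [Nonempty X],
      BoundaryMonoid.IsKuratowski X → BoundaryMonoid.kNumber X ≠ 6) ∧
    -- no space has `k_f`-number 12
    (∀ (X : Type u) [TopologicalSpace X] [Nonempty X], BoundaryMonoid.kfNumber X ≠ 12) ∧
    -- no KD space has `k_f`-number 20
    (∀ (X : Type u) [TopologicalSpace X] [Nonempty X],
      BoundaryMonoid.HasType X .KD → BoundaryMonoid.kfNumber X ≠ 20) := by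
  refine ⟨⟨BoundaryMonoid.kValues_GE, BoundaryMonoid.kValues_KD, BoundaryMonoid.kValues_ED,
    BoundaryMonoid.kValues_OU, BoundaryMonoid.kValues_EO, BoundaryMonoid.kValues_partition,
    BoundaryMonoid.kValues_discrete⟩,
    ⟨BoundaryMonoid.kfValues_GE, BoundaryMonoid.kfValues_KD, BoundaryMonoid.kfValues_ED,
    BoundaryMonoid.kfValues_OU, BoundaryMonoid.kfValues_EO, BoundaryMonoid.kfValues_partition,
    BoundaryMonoid.kfValues_discrete⟩, ?_, ?_, ?_⟩
  · intro X _ _ hX h6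
    have := BoundaryMonoid.eight_le_kNumber_of_isKuratowski hX
    omega
  · intro X _ _
    exact BoundaryMonoid.kfNumber_ne_twelve
  · intro X _ _ hX h20
    have := BoundaryMonoid.kfNumber_mem_of_KD hX
    omega
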